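/- Let $\mathbb{X}\subset\mathbb{R}^d$ be non-empty and compact, and let $f:\mathbb{X}\to\mathbb{R}^m$ be a random function whose prior is a Gaussian process with continuously differentiable mean and covariance functions. Observations of $f$ are noisy: $y(x)=f(x)+v$, with independent noise $v\sim\mathcal N(0,\Sigma^v(x))$, where $\Sigma^v(x)$ is positive definite and depends continuously on $x\in\mathbb{X}$. Let $\mathcal{D}=\{(x_i,y_i)\}_{i=1}^n$ be a fixed data set with $x_i\in\mathbb{X}$, and let $g:\mathbb{R}^m\to\mathbb{R}$ be affine. For a candidate set $\mathbf{x}=(\mathbf{x}_1,\dots,\mathbf{x}_q)\in\mathbb{X}^q$ let $y_{\mathcal D}(\mathbf{x})$ denote the vector of noisy observations at $\mathbf{x}$ under the posterior given $\mathcal{D}$, and for $y\in(\mathbb{R}^m)^q$ let $\mathcal{D}_{\mathbf{x}}(y)=\mathcal{D}\cup\{(\mathbf{x}_j,y_j)\}_{j=1}^q$. Put $A(\mathbf{x},y)=\max_{x'\in\mathbb{X}}\mathbb{E}[g(f(x'))\mid\mathcal{D}_{\mathbf{x}}(y)]$ and $\mu^*=\max_{x'\in\mathbb{X}}\mathbb{E}[g(f(x'))\mid\mathcal{D}]$.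 The Knowledge Gradient is $$\alpha_{\mathrm{KG}}(\mathbf{x})=\mathbb{E}\bigl[A(\mathbf{x},y_{\mathcal D}(\mathbf{x}))\mid\mathcal{D}\bigr]-\mu^*.$$ Let $\mu_{\mathcal D}(\mathbf{x})$ be the posterior mean of $(f(\mathbf{x}_1),\dots,f(\mathbf{x}_q))$, and let $L(\mathbf{x})\in\mathbb{R}^{qm\times s}$ be a root of the covariance matrix of $y_{\mathcal D}(\mathbf{x})$, i.e. $L(\mathbf{x})L(\mathbf{x})^{T}=\mathrm{Cov}(y_{\mathcal D}(\mathbf{x}))$ (for instance its Cholesky factor). Let $\epsilon^1,\epsilon^2,\dots$ be i.i.d. $\mathcal N(0,I_s)$, and let $$\hat\alpha_{\mathrm{KG},N}(\mathbf{x})=\frac1N\sum_{i=1}^N A\bigl(\mathbf{x},\mu_{\mathcal D}(\mathbf{x})+L(\mathbf{x})\epsilon^i\bigr)-\mu^*$$ be the sample average approximation. Then the expectations and the inner maxima over $\mathbb{X}$ exist, $\alpha_{\mathrm{KG}}$ attains its maximum $\alpha^*_{\mathrm{KG}}$ on $\mathbb{X}^q$, on a set $\mathcal{X}^*_{\mathrm{KG}}$,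 each $\hat\alpha_{\mathrm{KG},N}$ is bounded above, and it attains its maximum on $\mathbb{X}^q$ if $L$ is continuous. With $\hat\alpha^*_{\mathrm{KG},N}=\sup_{\mathbf{x}\in\mathbb{X}^q}\hat\alpha_{\mathrm{KG},N}(\mathbf{x})$ and $\hat{\mathbf{x}}^*_{\mathrm{KG},N}$ denoting any maximizer of $\hat\alpha_{\mathrm{KG},N}$ over $\mathbb{X}^q$: (1) $\hat\alpha^*_{\mathrm{KG},N}\to\alpha^*_{\mathrm{KG}}$ almost surely as $N\to\infty$; (2) $\operatorname{dist}(\hat{\mathbf{x}}^*_{\mathrm{KG},N},\mathcal{X}^*_{\mathrm{KG}})\to0$ almost surely, uniformly over the choice of the maximizers; (3) for every $\delta>0$ there are $K<\infty$ and $\beta>0$ such that for all $N\ge1$ the (outer) probability that some maximizer satisfies $\operatorname{dist}(\hat{\mathbf{x}}^*_{\mathrm{KG},N},\mathcal{X}^*_{\mathrm{KG}})>\delta$ is at most $Ke^{-\beta N}$. -/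

import Mathlib

open MeasureTheory ProbabilityTheory Filter Topology

namespace KG

/-- A data set of `n` observations, at points of `X ⊆ ℝᵈ`, of a function with values in `ℝᵐ`. -/
structure Data {d : ℕ} (X : Set (EuclideanSpace ℝ (Fin d))) (m n : ℕ) where
  /-- the observed points -/
  pts : Fin n → X
  /-- the observed noisy values -/
  obs : Fin n → EuclideanSpace ℝ (Fin m)

/-- `𝒟 ∪ {(x₁, y₁), …, (x_q, y_q)}`. -/
def Data.extend {d : ℕ} {X : Set (EuclideanSpace ℝ (Fin d))} {m n q : ℕ} (D : Data X m n)
    (x : Fin q → X) (y : Fin q → EuclideanSpace ℝ (Fin m)) : Data X m (n + q) where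
  pts := Fin.append D.pts x
  obs := Fin.append D.obs y

noncomputable section

variable {d m n q s : ℕ} {X : Set (EuclideanSpace ℝ (Fin d))} {Ω : Type*} [MeasurableSpace Ω]

/-- The log-likelihood, up to a constant, of the data `D` given the function `f · ω`, when each
value `f x` is observed with independent additive `N(0, Σᵥ(x))` noise. -/
def logLik (f : X → Ω → EuclideanSpace ℝ (Fin m)) (Sv : X → Matrix (Fin m) (Fin m) ℝ)
    (D : Data X m n) (ω : Ω) : ℝ :=
  -(1 / 2 : ℝ) * ∑ i, (D.obs i - f (D.pts i) ω).ofLp ⬝ᵥ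
    ((Sv (D.pts i))⁻¹.mulVec (D.obs i - f (D.pts i) ω).ofLp)

/-- The posterior given the data `D`, by Bayes' rule: the probability measure whose density with
respect to the prior `P` is proportional to the likelihood of `D`. The posterior process `f_𝒟` is
the process `f` under this measure. -/
def posterior (P : Measure Ω) (f : X → Ω → EuclideanSpace ℝ (Fin m))
    (Sv : X → Matrix (Fin m) (Fin m) ℝ) (D : Data X m n) : Measure Ω :=
  P.tilted (logLik f Sv D)

/-- `E[g(f(x')) | 𝒟]`. -/
def condMean (P : Measure Ω) (f : X → Ω → EuclideanSpace ℝ (Fin m))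
    (Sv : X → Matrix (Fin m) (Fin m) ℝ) (g : EuclideanSpace ℝ (Fin m) → ℝ) (D : Data X m n)
    (x' : X) : ℝ :=
  ∫ ω, g (f x' ω) ∂(posterior P f Sv D)

/-- `max_{x' ∈ X} E[g(f(x')) | 𝒟]`. -/
def bestMean (P : Measure Ω) (f : X → Ω → EuclideanSpace ℝ (Fin m))
    (Sv : X → Matrix (Fin m) (Fin m) ℝ) (g : EuclideanSpace ℝ (Fin m) → ℝ) (D : Data X m n) : ℝ :=
  ⨆ x' : X, condMean P f Sv g D x'

/-- The law of `y_𝒟(x)`, the noisy observations at the candidate points `x = (x₁, …, x_q)` given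
the data `D`: the posterior law of `f(x)` plus independent noise. -/
def predictive (P : Measure Ω) (f : X → Ω → EuclideanSpace ℝ (Fin m))
    (Sv : X → Matrix (Fin m) (Fin m) ℝ) (D : Data X m n) (x : Fin q → X) :
    Measure (Fin q → EuclideanSpace ℝ (Fin m)) :=
  ((posterior P f Sv D).prod (Measure.pi fun j => multivariateGaussian 0 (Sv (x j)))).map
    (fun p j => f (x j) p.1 + p.2 j)

/-- The Knowledge Gradient
`α_KG(x; 𝒟) = E[max_{x'} E[g(f(x')) | 𝒟_x] | 𝒟] - max_{x'} E[g(f(x')) | 𝒟]`. -/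
def alphaKG (P : Measure Ω) (f : X → Ω → EuclideanSpace ℝ (Fin m))
    (Sv : X → Matrix (Fin m) (Fin m) ℝ) (g : EuclideanSpace ℝ (Fin m) → ℝ) (D : Data X m n)
    (x : Fin q → X) : ℝ :=
  ∫ y, bestMean P f Sv g (D.extend x y) ∂(predictive P f Sv D x) - bestMean P f Sv g D

/-- The posterior mean of the components of `f(x₁), …, f(x_q)`. -/
def postMean (P : Measure Ω) (f : X → Ω → EuclideanSpace ℝ (Fin m))
    (Sv : X → Matrix (Fin m) (Fin m) ℝ) (D : Data X m n) (x : Fin q → X) :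
    Fin q × Fin m → ℝ :=
  fun a => ∫ ω, f (x a.1) ω a.2 ∂(posterior P f Sv D)

/-- The covariance matrix of `y_𝒟(x)`: the posterior covariance matrix of `f(x₁), …, f(x_q)` plus
the block diagonal noise covariance. -/
def predCov (P : Measure Ω) (f : X → Ω → EuclideanSpace ℝ (Fin m))
    (Sv : X → Matrix (Fin m) (Fin m) ℝ) (D : Data X m n) (x : Fin q → X) :
    Matrix (Fin q × Fin m) (Fin q × Fin m) ℝ :=
  fun a b => cov[fun ω => f (x a.1) ω a.2, fun ω => f (x b.1) ω b.2; posterior P f Sv D] +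
    if a.1 = b.1 then Sv (x a.1) a.2 b.2 else 0

/-- The reparameterized observation `y_𝒟(x) = μ_𝒟(x) + L(x) e` for a base sample `e`. -/
def fantasy (P : Measure Ω) (f : X → Ω → EuclideanSpace ℝ (Fin m))
    (Sv : X → Matrix (Fin m) (Fin m) ℝ) (D : Data X m n)
    (L : (Fin q → X) → Matrix (Fin q × Fin m) (Fin s) ℝ) (x : Fin q → X) (e : Fin s → ℝ) :
    Fin q → EuclideanSpace ℝ (Fin m) :=
  fun j => WithLp.toLp 2 fun k => postMean P f Sv D x (j, k) + (L x).mulVec e (j, k)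

/-- The sample average approximation `α̂_{KG,N}(x; 𝒟)` with base samples `e₀, …, e_{N-1}`. -/
def alphaHat (P : Measure Ω) (f : X → Ω → EuclideanSpace ℝ (Fin m))
    (Sv : X → Matrix (Fin m) (Fin m) ℝ) (g : EuclideanSpace ℝ (Fin m) → ℝ) (D : Data X m n)
    (L : (Fin q → X) → Matrix (Fin q × Fin m) (Fin s) ℝ) (e : ℕ → Fin s → ℝ) (N : ℕ)
    (x : Fin q → X) : ℝ :=
  (1 / (N : ℝ)) * ∑ i ∈ Finset.range N, bestMean P f Sv g (D.extend x (fantasy P f Sv D L x (e i)))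
    - bestMean P f Sv g D

/-- The set of global maximizers of `F`. -/
def argmax {α : Type*} (F : α → ℝ) : Set α := {x | ∀ z, F z ≤ F x}

end

end KG

namespace KG

/-! Everything reduces to a uniform law of large numbers with an exponential rate,
`expSmall_uniform`, for the integrand e ↦ A(x, μ(x) + L(x)e).

Conditioning is a tilt of the prior by the likelihood. On a linear space of Gaussian variables, the
tilt by one scalar observation with unit noise is computed by characteristic functions
(`tilted_neg_sq`). Whitening the noise reduces vector data to such scalar steps (`posterior_spec`).
The posterior mean is kept as an implicit equation in the posterior residuals, which survives
induction without matrix inverses. Solving it once gives the kriging formula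
`integral_posterior_extend`: the updated mean is affine in the new observations, with coefficients
continuous in the candidate points. Hence A is jointly continuous and grows at most linearly in y.

`L` may be discontinuous, so the uniform law is applied on the compact set `roots` of all pairs (x,
M) with M Mᵀ equal to the predictive covariance. The integral of the integrand at (x, M) depends on
x alone, because M e + μ has the predictive law for every root (`predictive_eq_map_fantasy`). This
transfers the law to the candidate sets (`expSmall_alphaHat_sub_alphaKG`) and makes `alphaKG`
continuous. A uniformly small error moves the supremum little. It also keeps maximizers out of the
compact set of points far from the true ones, where the objective has a strict gap. Borel–Cantelli
turns exponential rates into almost sure statements. -/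

/-- The outer probabilities of the events `A N` decay exponentially fast in `N`. -/
def ExpSmall {Ω' : Type*} [MeasurableSpace Ω'] (P' : Measure Ω') (A : ℕ → Set Ω') : Prop :=
  ∃ M : ℝ, 0 ≤ M ∧ ∃ β > 0, ∀ N : ℕ, 1 ≤ N → P' (A N) ≤ ENNReal.ofReal (M * Real.exp (-β * N))

/-! ### Calculus of exponentially small events. -/

namespace ExpSmall

variable {Ω' : Type*} [MeasurableSpace Ω'] {P' : Measure Ω'} {A B : ℕ → Set Ω'}

lemma mono (hB : ExpSmall P' B) (h : ∀ N, 1 ≤ N → A N ⊆ B N) : ExpSmall P' A := by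
  obtain ⟨M, hM, β, hβ, hN⟩ := hB
  exact ⟨M, hM, β, hβ, fun N h1 => (measure_mono (h N h1)).trans (hN N h1)⟩

lemma empty : ExpSmall P' fun _ => (∅ : Set Ω') := ⟨0, le_rfl, 1, one_pos, by simp⟩

lemma union (hA : ExpSmall P' A) (hB : ExpSmall P' B) : ExpSmall P' fun N => A N ∪ B N := by
  obtain ⟨M, hM, β, hβ, hN⟩ := hA
  obtain ⟨M', hM', β', hβ', hN'⟩ := hB
  refine ⟨M + M', by positivity, min β β', lt_min hβ hβ', fun N h1 => ?_⟩
  have e1 : Real.exp (-β * N) ≤ Real.exp (-min β β' * N) := by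
    gcongr; exact min_le_left _ _
  have e2 : Real.exp (-β' * N) ≤ Real.exp (-min β β' * N) := by
    gcongr; exact min_le_right _ _
  calc P' (A N ∪ B N) ≤ P' (A N) + P' (B N) := measure_union_le _ _
    _ ≤ ENNReal.ofReal (M * Real.exp (-β * N)) + ENNReal.ofReal (M' * Real.exp (-β' * N)) :=
      add_le_add (hN N h1) (hN' N h1)
    _ = ENNReal.ofReal (M * Real.exp (-β * N) + M' * Real.exp (-β' * N)) :=
      (ENNReal.ofReal_add (by positivity) (by positivity)).symm
    _ ≤ _ := by
      rw [add_mul]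
      gcongr

lemma biUnion {ι : Type*} {t : Set ι} (ht : t.Finite) {A : ι → ℕ → Set Ω'}
    (hA : ∀ i, ExpSmall P' (A i)) : ExpSmall P' fun N => ⋃ i ∈ t, A i N := by
  induction t, ht using Set.Finite.induction_on with
  | empty => simpa using empty
  | insert _ _ ih => simpa [Set.biUnion_insert] using (hA _).union ih

/-- Borel–Cantelli, which requires no measurability of the events. -/
lemma ae_eventually_notMem (hA : ExpSmall P' A) : ∀ᵐ ω ∂P', ∀ᶠ N in atTop, ω ∉ A N := by
  obtain ⟨M, hM, β, hβ, hN⟩ := hA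
  have hs : Summable fun N : ℕ => M * Real.exp (-β * N) := by
    refine Summable.mul_left _ ?_
    simpa [mul_comm] using Real.summable_exp_nat_mul_iff.mpr (show -β < 0 by linarith)
  -- The sum is shifted because nothing is known about `A 0`.
  have h : ∑' N, P' (A (N + 1)) ≠ ⊤ := by
    refine ne_top_of_le_ne_top ?_ (ENNReal.tsum_le_tsum fun N => hN (N + 1) (by omega))
    rw [← ENNReal.ofReal_tsum_of_nonneg (fun N => by positivity) ((summable_nat_add_iff 1).mpr hs)]
    exact ENNReal.ofReal_ne_top
  filter_upwards [MeasureTheory.ae_eventually_notMem h] with ω hω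
  obtain ⟨N, h⟩ := eventually_atTop.mp hω
  refine eventually_atTop.mpr ⟨N + 1, fun n hn => ?_⟩
  obtain ⟨k, rfl⟩ : ∃ k, n = k + 1 := ⟨n - 1, by omega⟩
  exact h k (by omega)

end ExpSmall

/-! ### Chernoff bounds and the uniform law of large numbers. -/

section LargeDeviations

variable {E Ω' : Type*} [MeasurableSpace E] [MeasurableSpace Ω'] {P' : Measure Ω'}
  [IsProbabilityMeasure P'] {γ : Measure E} {ε : ℕ → Ω' → E}

/-- Chernoff's bound for the empirical mean of a function all of whose exponential moments are
finite. -/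
lemma exists_chernoff_rate [IsProbabilityMeasure γ] (hlaw : ∀ i, HasLaw (ε i) γ P')
    (hind : iIndepFun ε P') {φ : E → ℝ} (hφ : Measurable φ)
    (hexp : ∀ t : ℝ, Integrable (fun e => Real.exp (t * φ e)) γ) {η : ℝ} (hη : 0 < η) :
    ∃ β > 0, ∀ N : ℕ, P' {ω | N * (∫ e, φ e ∂γ + η) ≤ ∑ i ∈ Finset.range N, φ (ε i ω)} ≤
      ENNReal.ofReal (Real.exp (-β * N)) := by
  set a := ∫ e, φ e ∂γ + η with ha
  have hset : integrableExpSet φ γ = Set.univ := Set.eq_univ_of_forall hexp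
  -- The Chernoff factor equals 1 at t = 0 and has slope -η there, so it drops below 1 at some t >
  -- 0; minus its logarithm is the rate.
  have hd : HasDerivAt (fun t => Real.exp (-t * a) * mgf φ γ t) (-η) 0 := by
    have h1 : HasDerivAt (mgf φ γ) (∫ e, φ e ∂γ) 0 := by
      simpa using hasDerivAt_mgf (X := φ) (μ := γ) (t := 0) (by simp [hset])
    have h2 : HasDerivAt (fun t : ℝ => Real.exp (-t * a)) (-a) 0 := by
      simpa using (((hasDerivAt_id (0 : ℝ)).neg.mul_const a).exp)
    refine (h2.mul h1).congr_deriv ?_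
    simp [ha]
  obtain ⟨t, ht0, ht1⟩ : ∃ t > 0, Real.exp (-t * a) * mgf φ γ t < 1 := by
    have := (hd.tendsto_slope.mono_left (nhdsGT_le_nhdsNE (0 : ℝ))).eventually_lt_const
      (show -η < 0 by linarith)
    obtain ⟨t, h1, h2⟩ := (this.and self_mem_nhdsWithin).exists
    refine ⟨t, h2, ?_⟩
    rw [slope_def_field, div_lt_iff₀ (by simpa using h2)] at h1
    simp at h1
    simpa using h1
  have hpos : 0 < Real.exp (-t * a) * mgf φ γ t := by
    have := mgf_pos (hexp t)
    positivity
  have hm : ∀ i, AEMeasurable (fun ω => φ (ε i ω)) P' := fun i =>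
    hφ.comp_aemeasurable (hlaw i).aemeasurable
  have hi : iIndepFun (fun i ω => φ (ε i ω)) P' := hind.comp (fun _ => φ) fun _ => hφ
  have hmgf : ∀ i, mgf (fun ω => φ (ε i ω)) P' t = mgf φ γ t := fun i => by
    rw [← (hlaw i).map_eq, mgf_map (hlaw i).aemeasurable (by fun_prop)]
    rfl
  refine ⟨-Real.log (Real.exp (-t * a) * mgf φ γ t), by
    simpa using Real.log_neg hpos ht1, fun N => ?_⟩
  have hint : Integrable (fun ω => Real.exp (t * (∑ i ∈ Finset.range N, fun ω => φ (ε i ω)) ω))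
      P' := by
    -- A non-integrable exponential would give the default value `mgf = 0`, but independence makes
    -- this `mgf` a product of positive factors.
    have hp : 0 < mgf (∑ i ∈ Finset.range N, fun ω => φ (ε i ω)) P' t := by
      rw [hi.mgf_sum₀ hm]
      exact Finset.prod_pos fun i _ => by rw [hmgf]; exact mgf_pos (hexp t)
    by_contra h
    rw [mgf, integral_undef h] at hp
    exact hp.false
  have hb := measure_ge_le_exp_mul_mgf (N * a) ht0.le hint
  rw [hi.mgf_sum₀ hm, Finset.prod_congr rfl fun i _ => hmgf i, Finset.prod_const,
    Finset.card_range] at hb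
  have he : Real.exp (-t * (N * a)) * mgf φ γ t ^ N =
      Real.exp (- -Real.log (Real.exp (-t * a) * mgf φ γ t) * N) := by
    rw [neg_neg, mul_comm _ (N : ℝ), Real.exp_nat_mul, Real.exp_log hpos, mul_pow,
      ← Real.exp_nat_mul]
    ring_nf
  rw [he] at hb
  refine le_trans (le_of_eq ?_) (ENNReal.ofReal_le_ofReal hb)
  simp [measureReal_def, Finset.sum_apply]

lemma expSmall_mean_ge [IsProbabilityMeasure γ] (hlaw : ∀ i, HasLaw (ε i) γ P')
    (hind : iIndepFun ε P') {φ : E → ℝ} (hφ : Measurable φ)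
    (hexp : ∀ t : ℝ, Integrable (fun e => Real.exp (t * φ e)) γ) {η : ℝ} (hη : 0 < η) :
    ExpSmall P' fun N => {ω | N * (∫ e, φ e ∂γ + η) ≤ ∑ i ∈ Finset.range N, φ (ε i ω)} := by
  obtain ⟨β, hβ, h⟩ := exists_chernoff_rate hlaw hind hφ hexp hη
  exact ⟨1, zero_le_one, β, hβ, fun N _ => by simpa using h N⟩

lemma integrable_exp_mul_of_abs_le {E : Type*} [NormedAddCommGroup E] [MeasurableSpace E]
    {γ : Measure E} (hexp : ∀ t : ℝ, Integrable (fun e => Real.exp (t * ‖e‖)) γ) {φ : E → ℝ}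
    (hφ : Measurable φ) {C : ℝ} (hC : ∀ e, |φ e| ≤ C * (1 + ‖e‖)) (t : ℝ) :
    Integrable (fun e => Real.exp (t * φ e)) γ := by
  refine ((hexp (|t| * C)).const_mul (Real.exp (|t| * C))).mono' (by fun_prop)
    (ae_of_all _ fun e => ?_)
  rw [Real.norm_of_nonneg (Real.exp_nonneg _), ← Real.exp_add, Real.exp_le_exp]
  calc t * φ e ≤ |t| * |φ e| := by rw [← abs_mul]; exact le_abs_self _
    _ ≤ |t| * (C * (1 + ‖e‖)) := by gcongr; exact hC e
    _ = _ := by ring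

lemma integrable_of_abs_le {E : Type*} [NormedAddCommGroup E] [MeasurableSpace E] [BorelSpace E]
    {γ : Measure E} (hexp : ∀ t : ℝ, Integrable (fun e => Real.exp (t * ‖e‖)) γ) {φ : E → ℝ}
    (hφ : Measurable φ) {C : ℝ} (hC : ∀ e, |φ e| ≤ C * (1 + ‖e‖)) : Integrable φ γ := by
  refine ((hexp 1).const_mul |C|).mono' hφ.aestronglyMeasurable (ae_of_all _ fun e => ?_)
  refine (hC e).trans (mul_le_mul (le_abs_self C) ?_ (by positivity) (abs_nonneg C))
  rw [one_mul, add_comm]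
  exact Real.add_one_le_exp _

/-- A uniform law of large numbers with an exponential rate, for a jointly continuous function of
at most linear growth. -/
theorem expSmall_uniform {K E : Type*} [PseudoMetricSpace K] [CompactSpace K]
    [NormedAddCommGroup E] [ProperSpace E] [MeasurableSpace E] [BorelSpace E]
    {γ : Measure E} [IsProbabilityMeasure γ] {ε : ℕ → Ω' → E}
    (hlaw : ∀ i, HasLaw (ε i) γ P') (hind : iIndepFun ε P')
    (hexp : ∀ t : ℝ, Integrable (fun e => Real.exp (t * ‖e‖)) γ)
    {H : K → E → ℝ} (hH : Continuous fun p : K × E => H p.1 p.2) {C : ℝ} (hC0 : 0 ≤ C)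
    (hC : ∀ k e, |H k e| ≤ C * (1 + ‖e‖)) {η : ℝ} (hη : 0 < η) :
    ExpSmall P' fun N => {ω | ∃ k,
      η < |1 / (N : ℝ) * ∑ i ∈ Finset.range N, H k (ε i ω) - ∫ e, H k e ∂γ|} := by
  have hHm : ∀ k, Measurable (H k) := fun k =>
    (hH.comp (Continuous.prodMk_right k)).measurable
  have hint : Integrable (fun e : E => 1 + ‖e‖) γ :=
    integrable_of_abs_le (C := 1) hexp (by fun_prop) fun e => by
      rw [one_mul, abs_of_nonneg (by positivity)]
  have hHi : ∀ k, Integrable (H k) γ := fun k => integrable_of_abs_le hexp (hHm k) (hC k)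
  -- `T R` dominates the oscillation of `H` in `k` outside the ball of radius `R`; inside,
  -- compactness gives uniform continuity.
  let T : ℝ → E → ℝ := fun R => {e : E | R < ‖e‖}.indicator fun e => 2 * C * (1 + ‖e‖)
  have hTm : ∀ R, Measurable (T R) := fun R =>
    Measurable.indicator (by fun_prop) (measurableSet_lt measurable_const measurable_norm)
  have hT0 : ∀ R e, 0 ≤ T R e := fun R e => Set.indicator_nonneg (fun e _ => by positivity) e
  have hTC : ∀ R e, |T R e| ≤ 2 * C * (1 + ‖e‖) := fun R e => by
    rw [abs_of_nonneg (hT0 R e)]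
    exact Set.indicator_le_self' (fun e _ => by positivity) e
  have hTi : ∀ R, Integrable (T R) γ := fun R => integrable_of_abs_le hexp (hTm R) (hTC R)
  obtain ⟨R, hR⟩ : ∃ R : ℝ, ∫ e, T R e ∂γ < η / 8 := by
    have h : Tendsto (fun R => ∫ e, T R e ∂γ) atTop (𝓝 (∫ _, (0 : ℝ) ∂γ)) := by
      refine tendsto_integral_filter_of_dominated_convergence _
        (Eventually.of_forall fun R => (hTm R).aestronglyMeasurable)
        (Eventually.of_forall fun R => ae_of_all _ (hTC R)) (hint.const_mul (2 * C))
        (ae_of_all _ fun e => ?_)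
      refine tendsto_const_nhds.congr' ?_
      filter_upwards [eventually_ge_atTop ‖e‖] with R hR
      simp [T, hR]
    rw [integral_zero] at h
    exact (h.eventually_lt_const (by positivity : 0 < η / 8)).exists
  obtain ⟨r, hr, hur⟩ := Metric.uniformContinuousOn_iff.mp
    ((isCompact_univ.prod (isCompact_closedBall (0 : E) R)).uniformContinuousOn_of_continuous
      hH.continuousOn) (η / 8) (by positivity)
  have hosc : ∀ k k', dist k k' < r → ∀ e, |H k e - H k' e| ≤ η / 8 + T R e := by
    intro k k' hk e
    by_cases he : R < ‖e‖
    · have : T R e = 2 * C * (1 + ‖e‖) := by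
        simp [T, he]
      have := abs_sub (H k e) (H k' e)
      linarith [hC k e, hC k' e]
    · have h1 := hur (k, e) (by simpa using not_lt.mp he) (k', e) (by simpa using not_lt.mp he)
        (by simpa [Prod.dist_eq] using hk)
      rw [Real.dist_eq] at h1
      linarith [hT0 R e]
  obtain ⟨t, -, ht, hcov⟩ := finite_cover_balls_of_compact (isCompact_univ (X := K)) hr
  have hexpH := fun k => integrable_exp_mul_of_abs_le hexp (hHm k) (hC k)
  have hneg : ∀ k, ∀ s : ℝ, Integrable (fun e => Real.exp (s * -H k e)) γ := fun k =>
    integrable_exp_mul_of_abs_le hexp (hHm k).neg (fun e => by simpa using hC k e)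
  -- The exceptional events are a large empirical mean of the tail and, at each of the finitely many
  -- centres of the cover, a deviation to either side.
  refine ((expSmall_mean_ge hlaw hind (hTm R) (integrable_exp_mul_of_abs_le hexp (hTm R) (hTC R))
    (by positivity : 0 < η / 8)).union (ExpSmall.biUnion ht fun k =>
      (expSmall_mean_ge hlaw hind (hHm k) (hexpH k) (by positivity : 0 < η / 4)).union
      (expSmall_mean_ge hlaw hind (φ := fun e => -H k e) (hHm k).neg (hneg k)
        (by positivity : 0 < η / 4)))).mono fun N hN ω hω => ?_
  by_contra hcon
  simp only [Set.mem_union, Set.mem_iUnion, Set.mem_ofPred_eq, not_or, not_exists, not_le,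
    integral_neg, Finset.sum_neg_distrib] at hcon
  obtain ⟨k, hk⟩ := hω
  obtain ⟨k', hk't, hkk'⟩ : ∃ k' ∈ t, dist k k' < r := by
    simpa using hcov (Set.mem_univ k)
  obtain ⟨h1, h2⟩ := hcon
  obtain ⟨h2, h3⟩ := h2 k' hk't
  have hN0 : (0 : ℝ) < N := by exact_mod_cast hN
  have hs : |∑ i ∈ Finset.range N, H k (ε i ω) - ∑ i ∈ Finset.range N, H k' (ε i ω)| ≤
      N * (η / 8) + ∑ i ∈ Finset.range N, T R (ε i ω) := by
    rw [← Finset.sum_sub_distrib]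
    refine (Finset.abs_sum_le_sum_abs _ _).trans
      ((Finset.sum_le_sum fun i _ => hosc k k' hkk' (ε i ω)).trans ?_)
    simp [Finset.sum_add_distrib]
  have hI : |∫ e, H k e ∂γ - ∫ e, H k' e ∂γ| ≤ η / 8 + ∫ e, T R e ∂γ := by
    rw [← integral_sub (hHi k) (hHi k')]
    refine (abs_integral_le_integral_abs).trans ?_
    refine (integral_mono ((hHi k).sub (hHi k')).abs ((integrable_const _).add (hTi R))
      (hosc k k' hkk')).trans ?_
    rw [integral_add' (integrable_const _) (hTi R)]
    simp
  have hbad : N * η < |∑ i ∈ Finset.range N, H k (ε i ω) - N * ∫ e, H k e ∂γ| := by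
    have : ∑ i ∈ Finset.range N, H k (ε i ω) - N * ∫ e, H k e ∂γ =
        N * (1 / (N : ℝ) * ∑ i ∈ Finset.range N, H k (ε i ω) - ∫ e, H k e ∂γ) := by
      field_simp
    rw [this, abs_mul, abs_of_pos hN0]
    gcongr
  -- Error budget per sample: below 3η/8 for moving the empirical mean to the centre, η/4 at the
  -- centre and η/4 for moving the integral back, so less than 7η/8 in all.
  refine hbad.not_ge (abs_le.mpr ?_)
  obtain ⟨a1, a2⟩ := abs_le.mp hs
  obtain ⟨b1, b2⟩ := abs_le.mp hI
  have b3 := mul_le_mul_of_nonneg_left b1 hN0.le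
  have b4 := mul_le_mul_of_nonneg_left b2 hN0.le
  have b5 := mul_lt_mul_of_pos_left hR hN0
  have b6 := mul_pos hN0 hη
  constructor <;> nlinarith

end LargeDeviations

/-! ### Bayesian updating of Gaussian spaces. -/

section Tilting

variable {Ω : Type*} [MeasurableSpace Ω] {Q : Measure Ω}

/-- A linear space of real random variables all of which are Gaussian. -/
def IsGaussianSpace (V : Submodule ℝ (Ω → ℝ)) (Q : Measure Ω) : Prop :=
  ∀ Z ∈ V, HasGaussianLaw Z Q

lemma integral_cexp_of_hasGaussianLaw {Z : Ω → ℝ} (h : HasGaussianLaw Z Q) :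
    ∫ ω, Complex.exp (Z ω * Complex.I) ∂Q =
      Complex.exp ((∫ ω, Z ω ∂Q : ℝ) * Complex.I - (Var[Z; Q] : ℝ) / 2) := by
  have h1 := charFun_gaussianReal (μ := ∫ ω, Z ω ∂Q) (v := Var[Z; Q].toNNReal) 1
  rw [← h.map_eq_gaussianReal, charFun_apply_real, integral_map h.aemeasurable (by fun_prop)] at h1
  simpa [variance_nonneg] using h1

lemma map_eq_gaussianReal_of_integral_cexp [IsProbabilityMeasure Q] {Z : Ω → ℝ}
    (hZ : AEMeasurable Z Q) {m v : ℝ} (hv : 0 ≤ v)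
    (h : ∀ t : ℝ, ∫ ω, Complex.exp ((t * Z ω : ℝ) * Complex.I) ∂Q =
      Complex.exp ((t * m : ℝ) * Complex.I - (v * t ^ 2 : ℝ) / 2)) :
    Q.map Z = gaussianReal m v.toNNReal := by
  have := Measure.isProbabilityMeasure_map hZ
  refine Measure.ext_of_charFun (funext fun t => ?_)
  rw [charFun_gaussianReal, charFun_apply_real, integral_map hZ (by fun_prop)]
  simpa [hv] using h t

/-- The likelihood is the characteristic function of a standard normal, so the quadratic exponent
becomes an average of exponents linear in `u`. -/
lemma exp_neg_sq_eq_integral (u : ℝ) : ((Real.exp (-(1 / 2) * u ^ 2) : ℝ) : ℂ) =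
    ∫ ξ, Complex.exp ((u * ξ : ℝ) * Complex.I) ∂(gaussianReal 0 1) := by
  have h := charFun_gaussianReal (μ := 0) (v := 1) u
  rw [charFun_apply_real] at h
  push_cast
  rw [h]
  congr 1
  push_cast
  ring

/-- After Fubini the inner integral is the characteristic function of `Z - ξ • U`, which is Gaussian
since `V` is a linear space. A Gaussian integral in ξ remains. The constant `A` may stay implicit:
it does not depend on `Z` and cancels on normalising. -/
lemma exists_integral_cexp_mul_exp {V : Submodule ℝ (Ω → ℝ)} (hV : IsGaussianSpace V Q)
    [IsProbabilityMeasure Q] {U : Ω → ℝ} (hU : U ∈ V) (c : ℝ) :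
    ∃ A : ℂ, ∀ Z ∈ V,
      ∫ ω, (Real.exp (-(1 / 2) * (c - U ω) ^ 2) : ℂ) * Complex.exp (Z ω * Complex.I) ∂Q =
      A * Complex.exp ((∫ ω, Z ω ∂Q : ℝ) * Complex.I - (Var[Z; Q] : ℝ) / 2 +
        ((c - ∫ ω, U ω ∂Q : ℝ) * Complex.I + (cov[U, Z; Q] : ℝ)) ^ 2 /
          (2 * (1 + Var[U; Q] : ℝ))) := by
  set w := 1 + Var[U; Q] with hw
  have hw0 : 0 < w := by have := variance_nonneg U Q; positivity
  have hwC : (w : ℂ) ≠ 0 := by exact_mod_cast hw0.ne'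
  refine ⟨(Real.sqrt (2 * Real.pi))⁻¹ * (Real.pi / -(-(w / 2 : ℂ))) ^ (1 / 2 : ℂ),
    fun Z hZ => ?_⟩
  have hUm := (hV U hU).aemeasurable
  have hZm := (hV Z hZ).aemeasurable
  have hU2 := (hV U hU).memLp_two
  have hZ2 := (hV Z hZ).memLp_two
  simp_rw [exp_neg_sq_eq_integral, ← integral_mul_const]
  rw [integral_integral_swap]
  · have hinner : ∀ ξ : ℝ, ∫ ω, Complex.exp (((c - U ω) * ξ : ℝ) * Complex.I) *
        Complex.exp (Z ω * Complex.I) ∂Q = Complex.exp ((c * ξ : ℝ) * Complex.I +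
        ((∫ ω, Z ω ∂Q - ξ * ∫ ω, U ω ∂Q : ℝ) * Complex.I -
          (Var[Z; Q] - 2 * ξ * cov[U, Z; Q] + ξ ^ 2 * Var[U; Q] : ℝ) / 2)) := by
      intro ξ
      have hmem : Z - ξ • U ∈ V := V.sub_mem hZ (V.smul_mem ξ hU)
      have hg := integral_cexp_of_hasGaussianLaw (hV _ hmem)
      have hE : ∫ ω, (Z - ξ • U) ω ∂Q = ∫ ω, Z ω ∂Q - ξ * ∫ ω, U ω ∂Q := by
        rw [integral_sub' (hV Z hZ).integrable ((hV U hU).integrable.smul ξ)]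
        simp [integral_const_mul]
      have hVar : Var[Z - ξ • U; Q] =
          Var[Z; Q] - 2 * ξ * cov[U, Z; Q] + ξ ^ 2 * Var[U; Q] := by
        rw [variance_sub hZ2 (hU2.const_smul ξ), variance_smul, covariance_smul_right,
          covariance_comm]
        ring
      rw [hE, hVar] at hg
      rw [Complex.exp_add, ← hg, ← integral_const_mul]
      refine integral_congr_ae (ae_of_all _ fun ω => ?_)
      simp only [← Complex.exp_add, Pi.sub_apply, Pi.smul_apply, smul_eq_mul]
      congr 1
      push_cast
      ring
    simp_rw [hinner]
    rw [integral_gaussianReal_eq_integral_smul one_ne_zero]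
    have hint : ∀ ξ : ℝ, gaussianPDFReal 0 1 ξ • Complex.exp ((c * ξ : ℝ) * Complex.I +
        ((∫ ω, Z ω ∂Q - ξ * ∫ ω, U ω ∂Q : ℝ) * Complex.I -
          (Var[Z; Q] - 2 * ξ * cov[U, Z; Q] + ξ ^ 2 * Var[U; Q] : ℝ) / 2)) =
        (Real.sqrt (2 * Real.pi))⁻¹ * Complex.exp (-(w / 2 : ℂ) * (ξ : ℂ) ^ 2 +
          ((c - ∫ ω, U ω ∂Q : ℝ) * Complex.I + (cov[U, Z; Q] : ℝ)) * ξ +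
          ((∫ ω, Z ω ∂Q : ℝ) * Complex.I - (Var[Z; Q] : ℝ) / 2)) := by
      intro ξ
      rw [gaussianPDFReal_def, Complex.real_smul]
      push_cast
      rw [mul_assoc, ← Complex.exp_add]
      simp only [mul_one]
      congr 2
      rw [hw]
      push_cast
      ring
    simp_rw [hint]
    rw [integral_const_mul, integral_cexp_quadratic (by simpa using hw0), mul_assoc]
    congr 3
    field_simp
    ring
  · refine Integrable.mono' (integrable_const (1 : ℝ)) ?_ (ae_of_all _ fun p => ?_)
    · have h1 : AEMeasurable (fun p : Ω × ℝ => U p.1) (Q.prod (gaussianReal 0 1)) := hUm.comp_fst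
      have h2 : AEMeasurable (fun p : Ω × ℝ => Z p.1) (Q.prod (gaussianReal 0 1)) := hZm.comp_fst
      unfold Function.uncurry
      refine AEMeasurable.aestronglyMeasurable ?_
      fun_prop
    · simp only [Function.uncurry, norm_mul, Complex.norm_exp_ofReal_mul_I, mul_one, le_refl]

/-- With κ = cov(U, Z) / (1 + Var U), the expression equals Var(Z - κU) + κ². Nonnegativity ensures
that `toNNReal` does not truncate the posterior variance. -/
lemma variance_tilted_nonneg {V : Submodule ℝ (Ω → ℝ)} (hV : IsGaussianSpace V Q)
    {U Z : Ω → ℝ} (hU : U ∈ V) (hZ : Z ∈ V) :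
    0 ≤ Var[Z; Q] - cov[U, Z; Q] ^ 2 / (1 + Var[U; Q]) := by
  have := (hV U hU).isProbabilityMeasure
  have hw0 : 0 < 1 + Var[U; Q] := by have := variance_nonneg U Q; positivity
  have h := variance_nonneg (Z - (cov[U, Z; Q] / (1 + Var[U; Q])) • U) Q
  rw [variance_sub (hV Z hZ).memLp_two ((hV U hU).memLp_two.const_smul _), variance_smul,
    covariance_smul_right, covariance_comm Z U] at h
  refine h.trans ?_
  have h3 : cov[U, Z; Q] ^ 2 / (1 + Var[U; Q]) -
      (2 * (cov[U, Z; Q] / (1 + Var[U; Q]) * cov[U, Z; Q]) -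
      (cov[U, Z; Q] / (1 + Var[U; Q])) ^ 2 * Var[U; Q]) =
      -(cov[U, Z; Q] / (1 + Var[U; Q])) ^ 2 := by
    field_simp
    ring
  nlinarith [sq_nonneg (cov[U, Z; Q] / (1 + Var[U; Q]))]

/-- The effect on a Gaussian space of conditioning on a noisy observation `c` of `U`. -/
lemma tilted_neg_sq {V : Submodule ℝ (Ω → ℝ)} (hV : IsGaussianSpace V Q)
    {U : Ω → ℝ} (hU : U ∈ V) (c : ℝ) :
    IsProbabilityMeasure (Q.tilted fun ω => -(1 / 2) * (c - U ω) ^ 2) ∧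
    ∀ Z ∈ V, (Q.tilted fun ω => -(1 / 2) * (c - U ω) ^ 2).map Z =
      gaussianReal (∫ ω, Z ω ∂Q + cov[U, Z; Q] * ((c - ∫ ω, U ω ∂Q) / (1 + Var[U; Q])))
        (Var[Z; Q] - cov[U, Z; Q] ^ 2 / (1 + Var[U; Q])).toNNReal := by
  have := (hV U hU).isProbabilityMeasure
  have hUm := (hV U hU).aemeasurable
  have hexp : Integrable (fun ω => Real.exp (-(1 / 2) * (c - U ω) ^ 2)) Q := by
    refine (integrable_const (1 : ℝ)).mono' (by fun_prop) (ae_of_all _ fun ω => ?_)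
    rw [Real.norm_of_nonneg (Real.exp_nonneg _), Real.exp_le_one_iff]
    nlinarith [sq_nonneg (c - U ω)]
  have hprob := isProbabilityMeasure_tilted hexp
  refine ⟨hprob, fun Z hZ => ?_⟩
  obtain ⟨A, hA⟩ := exists_integral_cexp_mul_exp hV hU c
  have hw0 : 0 < 1 + Var[U; Q] := by have := variance_nonneg U Q; positivity
  have hwC : (1 + Var[U; Q] : ℂ) ≠ 0 := by exact_mod_cast hw0.ne'
  refine map_eq_gaussianReal_of_integral_cexp
    ((hV Z hZ).aemeasurable.mono_ac (tilted_absolutelyContinuous _ _))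
    (variance_tilted_nonneg hV hU hZ) fun t => ?_
  -- The case `Z = 0` identifies the normalising constant of the tilt; dividing by it removes `A`.
  · have h0 := hA 0 V.zero_mem
    have ht := hA (t • Z) (V.smul_mem t hZ)
    simp only [Pi.zero_apply, Complex.ofReal_zero, zero_mul, Complex.exp_zero, mul_one,
      integral_zero, variance_zero, covariance_zero_right, zero_div, sub_zero, zero_add,
      add_zero] at h0
    rw [integral_complex_ofReal] at h0
    rw [integral_tilted]
    have hJ : ((∫ ω, Real.exp (-(1 / 2) * (c - U ω) ^ 2) ∂Q : ℝ) : ℂ) ≠ 0 := by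
      exact_mod_cast (integral_exp_pos hexp).ne'
    have hrw : ∀ ω, (Real.exp (-(1 / 2) * (c - U ω) ^ 2) /
        ∫ ω, Real.exp (-(1 / 2) * (c - U ω) ^ 2) ∂Q) •
          Complex.exp ((t * Z ω : ℝ) * Complex.I) =
        ((∫ ω, Real.exp (-(1 / 2) * (c - U ω) ^ 2) ∂Q : ℝ) : ℂ)⁻¹ *
        ((Real.exp (-(1 / 2) * (c - U ω) ^ 2) : ℂ) *
          Complex.exp (((t • Z) ω : ℝ) * Complex.I)) := by
      intro ω
      rw [Complex.real_smul, Complex.ofReal_div, Pi.smul_apply, smul_eq_mul]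
      ring
    simp_rw [hrw]
    rw [integral_const_mul, ht, inv_mul_eq_iff_eq_mul₀ hJ, h0, mul_assoc, ← Complex.exp_add]
    congr 2
    rw [variance_smul, covariance_smul_right]
    simp only [Pi.smul_apply, smul_eq_mul, integral_const_mul]
    push_cast
    field_simp
    ring_nf

lemma IsGaussianSpace.tilted {V : Submodule ℝ (Ω → ℝ)} (hV : IsGaussianSpace V Q)
    {U : Ω → ℝ} (hU : U ∈ V) (c : ℝ) :
    IsGaussianSpace V (Q.tilted fun ω => -(1 / 2) * (c - U ω) ^ 2) := fun Z hZ =>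
  ⟨by rw [(tilted_neg_sq hV hU c).2 Z hZ]; infer_instance⟩

lemma integral_tilted_neg_sq {V : Submodule ℝ (Ω → ℝ)} (hV : IsGaussianSpace V Q)
    {U Z : Ω → ℝ} (hU : U ∈ V) (c : ℝ) (hZ : Z ∈ V) :
    ∫ ω, Z ω ∂(Q.tilted fun ω => -(1 / 2) * (c - U ω) ^ 2) =
      ∫ ω, Z ω ∂Q + cov[U, Z; Q] * ((c - ∫ ω, U ω ∂Q) / (1 + Var[U; Q])) := by
  have hm := (hV.tilted hU c Z hZ).aemeasurable
  have h : ∫ x, x ∂((Q.tilted fun ω => -(1 / 2) * (c - U ω) ^ 2).map Z) = _ :=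
    integral_map hm (by fun_prop)
  rw [← h, (tilted_neg_sq hV hU c).2 Z hZ, integral_id_gaussianReal]

lemma variance_tilted_neg_sq {V : Submodule ℝ (Ω → ℝ)} (hV : IsGaussianSpace V Q)
    {U Z : Ω → ℝ} (hU : U ∈ V) (c : ℝ) (hZ : Z ∈ V) :
    Var[Z; Q.tilted fun ω => -(1 / 2) * (c - U ω) ^ 2] =
      Var[Z; Q] - cov[U, Z; Q] ^ 2 / (1 + Var[U; Q]) := by
  have hm := (hV.tilted hU c Z hZ).aemeasurable
  have h := variance_map (X := id) (by fun_prop) hm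
  rw [(tilted_neg_sq hV hU c).2 Z hZ, variance_id_gaussianReal, Function.id_comp,
    Real.coe_toNNReal _ (variance_tilted_nonneg hV hU hZ)] at h
  exact h.symm

/-- Polarization: `Y + Z` lies in `V` too, so the three variance formulas determine the covariance.
-/
lemma covariance_tilted_neg_sq {V : Submodule ℝ (Ω → ℝ)} (hV : IsGaussianSpace V Q)
    {U Y Z : Ω → ℝ} (hU : U ∈ V) (c : ℝ) (hY : Y ∈ V) (hZ : Z ∈ V) :
    cov[Y, Z; Q.tilted fun ω => -(1 / 2) * (c - U ω) ^ 2] =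
      cov[Y, Z; Q] - cov[U, Y; Q] * cov[U, Z; Q] / (1 + Var[U; Q]) := by
  have := (hV U hU).isProbabilityMeasure
  have := (tilted_neg_sq hV hU c).1
  have hV' := hV.tilted hU c
  have h1 := variance_add (hV' Y hY).memLp_two (hV' Z hZ).memLp_two
  rw [variance_tilted_neg_sq hV hU c hY, variance_tilted_neg_sq hV hU c hZ,
    variance_tilted_neg_sq hV hU c (V.add_mem hY hZ),
    variance_add (hV Y hY).memLp_two (hV Z hZ).memLp_two,
    covariance_add_right (hV U hU).memLp_two (hV Y hY).memLp_two (hV Z hZ).memLp_two] at h1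
  linear_combination (-1 / 2) * h1

/-- A Gaussian family with continuous mean and covariance functions. -/
structure IsContGaussian {T : Type*} [TopologicalSpace T] (F : T → Ω → ℝ) (Q : Measure Ω) :
    Prop where
  isProbabilityMeasure : IsProbabilityMeasure Q
  isGaussianSpace : IsGaussianSpace (Submodule.span ℝ (Set.range F)) Q
  continuous_mean : Continuous fun t => ∫ ω, F t ω ∂Q
  continuous_cov : Continuous fun p : T × T => cov[F p.1, F p.2; Q]

namespace IsContGaussian

variable {T : Type*} [TopologicalSpace T] {F : T → Ω → ℝ}

lemma mem_span {Ω T : Type*} (F : T → Ω → ℝ) (t : T) : F t ∈ Submodule.span ℝ (Set.range F) :=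
  Submodule.subset_span ⟨t, rfl⟩

lemma memLp_two (hF : IsContGaussian F Q) {U : Ω → ℝ}
    (hU : U ∈ Submodule.span ℝ (Set.range F)) : MemLp U 2 Q :=
  (hF.isGaussianSpace U hU).memLp_two

lemma continuous_cov_left (hF : IsContGaussian F Q) {U : Ω → ℝ}
    (hU : U ∈ Submodule.span ℝ (Set.range F)) : Continuous fun t => cov[U, F t; Q] := by
  have := hF.isProbabilityMeasure
  induction hU using Submodule.span_induction with
  | mem U h =>
    obtain ⟨t, rfl⟩ := h
    exact hF.continuous_cov.comp (Continuous.prodMk_right t)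
  | zero => simpa using continuous_const
  | add U U' hU hU' h h' =>
    have : ∀ t, cov[U + U', F t; Q] = cov[U, F t; Q] + cov[U', F t; Q] := fun t =>
      covariance_add_left (hF.memLp_two hU) (hF.memLp_two hU') (hF.memLp_two (mem_span F t))
    simp_rw [this]
    exact h.add h'
  | smul a U hU h =>
    simp_rw [covariance_smul_left]
    exact h.const_mul a

lemma tilted (hF : IsContGaussian F Q) {U : Ω → ℝ}
    (hU : U ∈ Submodule.span ℝ (Set.range F)) (c : ℝ) :
    IsContGaussian F (Q.tilted fun ω => -(1 / 2) * (c - U ω) ^ 2) where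
  isProbabilityMeasure := (tilted_neg_sq hF.isGaussianSpace hU c).1
  isGaussianSpace := hF.isGaussianSpace.tilted hU c
  continuous_mean := by
    simp_rw [fun t => integral_tilted_neg_sq hF.isGaussianSpace hU c (mem_span F t)]
    exact hF.continuous_mean.add ((hF.continuous_cov_left hU).mul_const _)
  continuous_cov := by
    simp_rw [fun s t => covariance_tilted_neg_sq hF.isGaussianSpace hU c (mem_span F s)
      (mem_span F t)]
    have h := hF.continuous_cov_left hU
    exact hF.continuous_cov.sub (((h.comp continuous_fst).mul (h.comp continuous_snd)).div_const _)

/-- Conditioning a Gaussian family on noisy observations `c i` of elements `U i` of its span. -/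
lemma tilted_sum {ι : Type*} (s : Finset ι) {U : ι → Ω → ℝ}
    (hU : ∀ i, U i ∈ Submodule.span ℝ (Set.range F)) (c : ι → ℝ) :
    ∀ {Q : Measure Ω}, IsContGaussian F Q →
      IsContGaussian F (Q.tilted fun ω => ∑ i ∈ s, -(1 / 2) * (c i - U i ω) ^ 2) ∧
      ∀ Z ∈ Submodule.span ℝ (Set.range F),
        ∫ ω, Z ω ∂(Q.tilted fun ω => ∑ i ∈ s, -(1 / 2) * (c i - U i ω) ^ 2) =
          ∫ ω, Z ω ∂Q + ∑ i ∈ s, cov[Z, U i; Q] *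
            (c i - ∫ ω, U i ω ∂(Q.tilted fun ω => ∑ i ∈ s, -(1 / 2) * (c i - U i ω) ^ 2)) := by
  classical
  induction s using Finset.induction_on with
  | empty =>
    intro Q hF
    have := hF.isProbabilityMeasure
    simpa using hF
  | insert i₀ s hi ih =>
    intro Q hF
    have := hF.isProbabilityMeasure
    have hV := hF.isGaussianSpace
    have hUm := (hV _ (hU i₀)).aemeasurable
    have hexp : Integrable (fun ω => Real.exp (-(1 / 2) * (c i₀ - U i₀ ω) ^ 2)) Q := by
      refine (integrable_const (1 : ℝ)).mono' (by fun_prop) (ae_of_all _ fun ω => ?_)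
      rw [Real.norm_of_nonneg (Real.exp_nonneg _), Real.exp_le_one_iff]
      nlinarith [sq_nonneg (c i₀ - U i₀ ω)]
    have heq : (Q.tilted fun ω => ∑ i ∈ insert i₀ s, -(1 / 2) * (c i - U i ω) ^ 2) =
        (Q.tilted fun ω => -(1 / 2) * (c i₀ - U i₀ ω) ^ 2).tilted
          fun ω => ∑ i ∈ s, -(1 / 2) * (c i - U i ω) ^ 2 := by
      rw [tilted_tilted hexp]
      congr 1
      ext ω
      simp [Finset.sum_insert hi]
    -- The induction hypothesis is needed at the once-tilted measure, which is why `Q` is bound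
    -- after the colon.
    obtain ⟨h1, h2⟩ := ih (hF.tilted (hU i₀) (c i₀))
    rw [heq]
    refine ⟨h1, fun Z hZ => ?_⟩
    rw [Finset.sum_insert hi]
    set Q₂ := (Q.tilted fun ω => -(1 / 2) * (c i₀ - U i₀ ω) ^ 2).tilted
          fun ω => ∑ i ∈ s, -(1 / 2) * (c i - U i ω) ^ 2
    -- Only covariances under `Q` appear here. The case `Y = U i₀` expresses the final residual of
    -- `U i₀` through the prior one; substituting it yields the missing summand.
    have key : ∀ Y ∈ Submodule.span ℝ (Set.range F), ∫ ω, Y ω ∂Q₂ = ∫ ω, Y ω ∂Q +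
        cov[U i₀, Y; Q] * ((c i₀ - ∫ ω, U i₀ ω ∂Q) / (1 + Var[U i₀; Q])) +
        (∑ i ∈ s, cov[Y, U i; Q] * (c i - ∫ ω, U i ω ∂Q₂) -
        cov[U i₀, Y; Q] / (1 + Var[U i₀; Q]) *
          ∑ i ∈ s, cov[U i₀, U i; Q] * (c i - ∫ ω, U i ω ∂Q₂)) := by
      intro Y hY
      rw [h2 Y hY, integral_tilted_neg_sq hV (hU i₀) _ hY, Finset.mul_sum,
        ← Finset.sum_sub_distrib]
      congr 1
      refine Finset.sum_congr rfl fun i _ => ?_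
      rw [covariance_tilted_neg_sq hV (hU i₀) _ hY (hU i)]
      ring
    have k1 := key Z hZ
    have k2 := key _ (hU i₀)
    rw [covariance_self hUm] at k2
    have hw0 : 0 < 1 + Var[U i₀; Q] := by have := variance_nonneg (U i₀) Q; positivity
    rw [k1, covariance_comm Z (U i₀), k2]
    field_simp
    ring

end IsContGaussian

end Tilting

/-! ### The posterior process and the kriging formula. -/

section Posterior

variable {d m n q : ℕ} {X : Set (EuclideanSpace ℝ (Fin d))} {Ω : Type*} [MeasurableSpace Ω]
  {Q : Measure Ω} {f : X → Ω → EuclideanSpace ℝ (Fin m)} {Sv : X → Matrix (Fin m) (Fin m) ℝ}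

/-- The components of a vector-valued process, as a real-valued process. -/
def coords (f : X → Ω → EuclideanSpace ℝ (Fin m)) (p : X × Fin m) (ω : Ω) : ℝ := f p.1 ω p.2

lemma isGaussianSpace_coords (hf : IsGaussianProcess f Q) :
    IsGaussianSpace (Submodule.span ℝ (Set.range (coords f))) Q := by
  have hp : IsGaussianProcess (coords f) Q := hf.of_isGaussianProcess fun p =>
    ⟨{p.1}, (EuclideanSpace.proj p.2).comp (ContinuousLinearMap.proj ⟨p.1, by simp⟩), fun ω => rfl⟩
  intro Z hZ
  obtain ⟨c, rfl⟩ := Finsupp.mem_span_range_iff_exists_finsupp.mp hZ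
  exact (hp.smul c).hasGaussianLaw_sum (I := c.support)

lemma isContGaussian_coords [IsProbabilityMeasure Q] (hf : IsGaussianProcess f Q)
    {μ₀ : EuclideanSpace ℝ (Fin d) → EuclideanSpace ℝ (Fin m)}
    {k₀ : EuclideanSpace ℝ (Fin d) → EuclideanSpace ℝ (Fin d) → Matrix (Fin m) (Fin m) ℝ}
    (hmean : ∀ (x : X) (i : Fin m), ∫ ω, f x ω i ∂Q = μ₀ x i)
    (hcov : ∀ (x y : X) (i j : Fin m), cov[fun ω => f x ω i, fun ω => f y ω j; Q] = k₀ x y i j)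
    (hμ₀ : ContinuousOn μ₀ X)
    (hk₀ : ∀ i j : Fin m, ContinuousOn
      (fun p : EuclideanSpace ℝ (Fin d) × EuclideanSpace ℝ (Fin d) => k₀ p.1 p.2 i j) (X ×ˢ X)) :
    IsContGaussian (coords f) Q where
  isProbabilityMeasure := inferInstance
  isGaussianSpace := isGaussianSpace_coords hf
  continuous_mean := by
    refine continuous_prod_of_discrete_right.mpr fun i => ?_
    simp only [coords, hmean]
    exact (EuclideanSpace.proj i).continuous.comp (continuousOn_iff_continuous_domRestrict.mp hμ₀)
  continuous_cov := by
    have h : Continuous fun p : (X × X) × (Fin m × Fin m) => k₀ p.1.1 p.1.2 p.2.1 p.2.2 :=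
      continuous_prod_of_discrete_right.mpr fun ij => (hk₀ ij.1 ij.2).comp_continuous
        (f := fun p : X × X => ((p.1 : EuclideanSpace ℝ (Fin d)), (p.2 : EuclideanSpace ℝ (Fin d))))
        (by fun_prop) fun p => ⟨p.1.2, p.2.2⟩
    have hc : ∀ p : (X × Fin m) × (X × Fin m), cov[coords f p.1, coords f p.2; Q] =
        k₀ p.1.1 p.2.1 p.1.2 p.2.2 := fun p => hcov p.1.1 p.2.1 p.1.2 p.2.2
    simp_rw [hc]
    exact h.comp (g := fun p : (X × X) × (Fin m × Fin m) => k₀ p.1.1 p.1.2 p.2.1 p.2.2)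
      (f := fun p : (X × Fin m) × (X × Fin m) => ((p.1.1, p.2.1), (p.1.2, p.2.2)))
      (by fun_prop)

-- Whitening: `B` turns an observation with noise covariance `S` into scalar observations with
-- independent unit noise.
open scoped MatrixOrder in
lemma exists_transpose_mul_self_eq_inv {S : Matrix (Fin m) (Fin m) ℝ} (hS : S.PosDef) :
    ∃ B : Matrix (Fin m) (Fin m) ℝ, B.transpose * B = S⁻¹ := by
  obtain ⟨B, hB⟩ := CStarAlgebra.nonneg_iff_eq_star_mul_self.mp hS.posSemidef.inv.nonneg
  exact ⟨B, hB.symm⟩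

lemma dotProduct_transpose_mul_self_mulVec {ι : Type*} [Fintype ι] (B : Matrix ι ι ℝ)
    (a b : ι → ℝ) : a ⬝ᵥ (B.transpose * B).mulVec b = ∑ k, B.mulVec a k * B.mulVec b k := by
  rw [← Matrix.mulVec_mulVec, Matrix.dotProduct_mulVec, Matrix.vecMul_transpose]
  rfl

/-- The posterior is a Gaussian process with continuous moments, and the equation that its mean
satisfies. -/
lemma posterior_spec (hF : IsContGaussian (coords f) Q) (hSv : ∀ x, (Sv x).PosDef)
    (D : Data X m n) :
    IsContGaussian (coords f) (posterior Q f Sv D) ∧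
    ∀ Z ∈ Submodule.span ℝ (Set.range (coords f)),
      ∫ ω, Z ω ∂(posterior Q f Sv D) = ∫ ω, Z ω ∂Q +
        ∑ i, (fun k => cov[Z, coords f (D.pts i, k); Q]) ⬝ᵥ (Sv (D.pts i))⁻¹.mulVec
          fun k => D.obs i k - ∫ ω, coords f (D.pts i, k) ω ∂(posterior Q f Sv D) := by
  choose B hB using fun i => exists_transpose_mul_self_eq_inv (hSv (D.pts i))
  -- `U` and `c` are the whitened process values and the whitened data.
  let U : Fin n × Fin m → Ω → ℝ := fun p => ∑ l, B p.1 p.2 l • coords f (D.pts p.1, l)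
  let c : Fin n × Fin m → ℝ := fun p => (B p.1).mulVec (D.obs p.1).ofLp p.2
  have hU : ∀ p, U p ∈ Submodule.span ℝ (Set.range (coords f)) := fun p =>
    Submodule.sum_mem _ fun l _ => Submodule.smul_mem _ _ (IsContGaussian.mem_span _ _)
  have hlik : posterior Q f Sv D = Q.tilted fun ω => ∑ p, -(1 / 2) * (c p - U p ω) ^ 2 := by
    rw [posterior]
    congr 1
    ext ω
    rw [logLik, Finset.mul_sum, Fintype.sum_prod_type]
    refine Finset.sum_congr rfl fun i _ => ?_
    rw [← hB i, dotProduct_transpose_mul_self_mulVec, Finset.mul_sum]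
    refine Finset.sum_congr rfl fun k _ => ?_
    have : c (i, k) - U (i, k) ω = (B i).mulVec (D.obs i - f (D.pts i) ω).ofLp k := by
      simp only [c, U, WithLp.ofLp_sub, Matrix.mulVec_sub, Pi.sub_apply, Finset.sum_apply]
      rfl
    rw [this, pow_two]
  obtain ⟨h1, h2⟩ := hF.tilted_sum Finset.univ hU c
  rw [← hlik] at h1 h2
  refine ⟨h1, fun Z hZ => ?_⟩
  have := hF.isProbabilityMeasure
  rw [h2 Z hZ, Fintype.sum_prod_type]
  congr 1
  refine Finset.sum_congr rfl fun i _ => ?_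
  rw [← hB i, dotProduct_transpose_mul_self_mulVec]
  refine Finset.sum_congr rfl fun k _ => ?_
  congr 1
  · rw [covariance_sum_right (fun l => (hF.memLp_two (IsContGaussian.mem_span _ _)).const_smul _)
      (hF.memLp_two hZ)]
    simp_rw [covariance_smul_right]
    rfl
  · have hI : ∫ ω, U (i, k) ω ∂(posterior Q f Sv D) =
        ∑ l, B i k l * ∫ ω, coords f (D.pts i, l) ω ∂(posterior Q f Sv D) := by
      simp only [U, Finset.sum_apply, Pi.smul_apply, smul_eq_mul]
      have h3 := fun l => (h1.isGaussianSpace _ (IsContGaussian.mem_span _ (D.pts i, l))).integrable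
      rw [integral_finsetSum _ fun l _ => (h3 l).const_mul _]
      simp_rw [integral_const_mul]
    rw [hI]
    simp only [c, Matrix.mulVec, dotProduct, mul_sub, Finset.sum_sub_distrib]

/-- Likelihoods multiply and tilts compose, so the data may be absorbed in two batches. -/
lemma posterior_extend (hF : IsContGaussian (coords f) Q) (hSv : ∀ x, (Sv x).PosDef)
    (D : Data X m n) (x : Fin q → X) (y : Fin q → EuclideanSpace ℝ (Fin m)) :
    posterior Q f Sv (D.extend x y) = posterior (posterior Q f Sv D) f Sv ⟨x, y⟩ := by
  have hprob := (posterior_spec hF hSv D).1.isProbabilityMeasure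
  have hexp : Integrable (fun ω => Real.exp (logLik f Sv D ω)) Q := by
    -- Tilting by a non-integrable density gives the zero measure by default, which is not a
    -- probability measure.
    by_contra h
    rw [posterior, tilted_of_not_integrable h] at hprob
    exact hprob.ne_zero _ rfl
  rw [posterior, posterior, posterior, tilted_tilted hexp]
  congr 1
  ext ω
  simp [logLik, Data.extend, Fin.sum_univ_add]
  ring

lemma dotProduct_predCov_mulVec (D : Data X m n) (x : Fin q → X)
    (hF : IsContGaussian (coords f) (posterior Q f Sv D)) (v : Fin q × Fin m → ℝ) :
    v ⬝ᵥ (predCov Q f Sv D x).mulVec v =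
      Var[∑ a, v a • coords f (x a.1, a.2); posterior Q f Sv D] +
        ∑ j, (fun k => v (j, k)) ⬝ᵥ (Sv (x j)).mulVec fun k => v (j, k) := by
  have := hF.isProbabilityMeasure
  have hL := fun a : Fin q × Fin m =>
    hF.memLp_two (IsContGaussian.mem_span (coords f) (x a.1, a.2))
  rw [← covariance_self (memLp_finsetSum' _ fun a _ => (hL a).const_smul _).aemeasurable,
    covariance_sum_sum (fun a => (hL a).const_smul _) (fun a => (hL a).const_smul _)]
  simp_rw [covariance_smul_left, covariance_smul_right]
  simp only [dotProduct, Matrix.mulVec, predCov, add_mul, Finset.sum_add_distrib, mul_add,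
    Finset.mul_sum]
  congr 1
  · refine Finset.sum_congr rfl fun a _ => Finset.sum_congr rfl fun b _ => ?_
    exact congrArg (v a * ·) (mul_comm _ _)
  · rw [Fintype.sum_prod_type]
    refine Finset.sum_congr rfl fun j _ => Finset.sum_congr rfl fun k _ => ?_
    rw [Fintype.sum_prod_type, Finset.sum_eq_single j]
    · simp
    · intro i _ hi
      simp [hi.symm]
    · simp

/-- On a kernel vector the process variance and the noise form, both nonnegative, sum to zero; the
noise form is definite. -/
lemma isUnit_predCov (D : Data X m n) (x : Fin q → X)
    (hF : IsContGaussian (coords f) (posterior Q f Sv D)) (hSv : ∀ x, (Sv x).PosDef) :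
    IsUnit (predCov Q f Sv D x) := by
  rw [← Matrix.mulVec_injective_iff_isUnit, ← Matrix.coe_mulVecLin, injective_iff_map_eq_zero]
  intro v hv
  have h := dotProduct_predCov_mulVec D x hF v
  rw [← Matrix.mulVecLin_apply, hv, dotProduct_zero] at h
  have hnn : ∀ j, 0 ≤ (fun k => v (j, k)) ⬝ᵥ (Sv (x j)).mulVec fun k => v (j, k) := fun j =>
    (hSv (x j)).posSemidef.dotProduct_mulVec_nonneg _
  have hvar := variance_nonneg (∑ a, v a • coords f (x a.1, a.2)) (posterior Q f Sv D)
  have hz : ∑ j, (fun k => v (j, k)) ⬝ᵥ (Sv (x j)).mulVec (fun k => v (j, k)) = 0 :=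
    le_antisymm (by linarith) (Finset.sum_nonneg fun j _ => hnn j)
  ext ⟨j, k⟩
  by_contra hne
  have h1 := (Finset.sum_eq_zero_iff_of_nonneg fun j _ => hnn j).mp hz j (Finset.mem_univ j)
  have h2 := (hSv (x j)).dotProduct_mulVec_pos (x := fun k => v (j, k))
    fun h0 => hne (congrFun h0 k)
  exact h2.ne' h1

lemma continuous_predCov (hSvc : Continuous Sv) (D : Data X m n)
    (hF : IsContGaussian (coords f) (posterior Q f Sv D)) :
    Continuous (predCov (q := q) Q f Sv D) := by
  refine continuous_matrix fun a b => ?_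
  refine Continuous.add ?_ ?_
  · exact hF.continuous_cov.comp (f := fun x : Fin q → X => ((x a.1, a.2), (x b.1, b.2)))
      (by fun_prop)
  · split_ifs
    · exact (hSvc.comp (continuous_apply a.1)).matrix_elem _ _
    · exact continuous_const

lemma continuous_postMean (D : Data X m n)
    (hF : IsContGaussian (coords f) (posterior Q f Sv D)) :
    Continuous (postMean (q := q) Q f Sv D) :=
  continuous_pi fun a => hF.continuous_mean.comp (f := fun x : Fin q → X => (x a.1, a.2))
    (by fun_prop)

lemma continuous_predCov_inv (hSvc : Continuous Sv) (hSv : ∀ x, (Sv x).PosDef) (D : Data X m n)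
    (hF : IsContGaussian (coords f) (posterior Q f Sv D)) :
    Continuous fun x : Fin q → X => (predCov Q f Sv D x)⁻¹ := by
  refine continuous_iff_continuousAt.mpr fun x => ContinuousAt.comp
    (continuousAt_matrix_inv _ ?_) (continuous_predCov hSvc D hF).continuousAt
  rw [Ring.inverse_eq_inv']
  exact continuousAt_inv₀ ((Matrix.isUnit_iff_isUnit_det _).mp (isUnit_predCov D x hF hSv)).ne_zero

/-- Kriging: the posterior mean after further observations `y` at `x`. -/
lemma integral_posterior_extend (hF : IsContGaussian (coords f) Q) (hSv : ∀ x, (Sv x).PosDef)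
    (D : Data X m n) (x : Fin q → X) (y : Fin q → EuclideanSpace ℝ (Fin m)) {Z : Ω → ℝ}
    (hZ : Z ∈ Submodule.span ℝ (Set.range (coords f))) :
    ∫ ω, Z ω ∂(posterior Q f Sv (D.extend x y)) = ∫ ω, Z ω ∂(posterior Q f Sv D) +
      (fun a : Fin q × Fin m => cov[Z, coords f (x a.1, a.2); posterior Q f Sv D]) ⬝ᵥ
        (predCov Q f Sv D x)⁻¹.mulVec fun a => y a.1 a.2 - postMean Q f Sv D x a := by
  have hF₁ := (posterior_spec hF hSv D).1
  have hF₂ := (posterior_spec hF₁ hSv (⟨x, y⟩ : Data X m q)).2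
  rw [posterior_extend hF hSv]
  set Q₂ := posterior (posterior Q f Sv D) f Sv ⟨x, y⟩
  -- `r` is the noise precision applied to the posterior residuals. The implicit mean equation at
  -- the observed coordinates says that `predCov` maps `r` to `y` minus the prior mean, which can be
  -- solved for `r`.
  let r : Fin q × Fin m → ℝ := fun a => (Sv (x a.1))⁻¹.mulVec
    (fun k => y a.1 k - ∫ ω, coords f (x a.1, k) ω ∂Q₂) a.2
  have hr : ∀ Y ∈ Submodule.span ℝ (Set.range (coords f)), ∫ ω, Y ω ∂Q₂ =
      ∫ ω, Y ω ∂(posterior Q f Sv D) +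
      (fun a : Fin q × Fin m => cov[Y, coords f (x a.1, a.2); posterior Q f Sv D]) ⬝ᵥ r := by
    intro Y hY
    rw [hF₂ Y hY]
    congr 1
    simp only [dotProduct, Fintype.sum_prod_type, r]
  have hS : ∀ j k, ∑ l, Sv (x j) k l * r (j, l) = y j k - ∫ ω, coords f (x j, k) ω ∂Q₂ := by
    intro j k
    have hu : IsUnit (Sv (x j)).det := (Matrix.isUnit_iff_isUnit_det _).mp (hSv (x j)).isUnit
    have : (Sv (x j)).mulVec ((Sv (x j))⁻¹.mulVec
        fun k => y j k - ∫ ω, coords f (x j, k) ω ∂Q₂) =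
        fun k => y j k - ∫ ω, coords f (x j, k) ω ∂Q₂ := by
      rw [Matrix.mulVec_mulVec, Matrix.mul_nonsing_inv _ hu, Matrix.one_mulVec]
    exact congrFun this k
  have hmul : (predCov Q f Sv D x).mulVec r = fun a => y a.1 a.2 - postMean Q f Sv D x a := by
    ext ⟨j, k⟩
    have h1 := hr _ (IsContGaussian.mem_span (coords f) (x j, k))
    have h2 : (predCov Q f Sv D x).mulVec r (j, k) = (fun a : Fin q × Fin m =>
        cov[coords f (x j, k), coords f (x a.1, a.2); posterior Q f Sv D]) ⬝ᵥ r +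
        ∑ l, Sv (x j) k l * r (j, l) := by
      simp only [Matrix.mulVec, dotProduct, predCov, add_mul, Finset.sum_add_distrib]
      congr 1
      rw [Fintype.sum_prod_type, Finset.sum_eq_single j]
      · simp
      · intro i _ hi
        simp [hi.symm]
      · simp
    rw [h2, hS, h1]
    simp only [postMean, coords]
    ring
  have hu := (Matrix.isUnit_iff_isUnit_det _).mp (isUnit_predCov D x hF₁ hSv)
  rw [hr Z hZ, ← hmul, Matrix.mulVec_mulVec, Matrix.nonsing_inv_mul _ hu, Matrix.one_mulVec]

end Posterior

/-! ### Continuity and growth of the optimal conditional mean. -/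

section BestMean

variable {d m n q : ℕ} {X : Set (EuclideanSpace ℝ (Fin d))} {Ω : Type*} [MeasurableSpace Ω]
  {Q : Measure Ω} {f : X → Ω → EuclideanSpace ℝ (Fin m)} {Sv : X → Matrix (Fin m) (Fin m) ℝ}
  (g : EuclideanSpace ℝ (Fin m) →ᵃ[ℝ] ℝ)

/-- The linear part of `g (f x')`. -/
noncomputable def objective (f : X → Ω → EuclideanSpace ℝ (Fin m)) (g : EuclideanSpace ℝ (Fin m) →ᵃ[ℝ] ℝ)
    (x' : X) : Ω → ℝ :=
  ∑ k, g.linear (EuclideanSpace.single k 1) • coords f (x', k)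

lemma objective_mem_span {Ω : Type*} {f : X → Ω → EuclideanSpace ℝ (Fin m)} (x' : X) :
    objective f g x' ∈ Submodule.span ℝ (Set.range (coords f)) :=
  Submodule.sum_mem _ fun _ _ => Submodule.smul_mem _ _ (IsContGaussian.mem_span _ _)

lemma linear_eq_sum {m : ℕ} {F : Type*} [AddCommGroup F] [Module ℝ F]
    (φ : EuclideanSpace ℝ (Fin m) →ₗ[ℝ] F) (v : EuclideanSpace ℝ (Fin m)) :
    φ v = ∑ k, v k • φ (EuclideanSpace.single k 1) := by
  conv_lhs => rw [← (EuclideanSpace.basisFun (Fin m) ℝ).sum_repr v]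
  simp

lemma affine_eq_objective {Ω : Type*} {f : X → Ω → EuclideanSpace ℝ (Fin m)} (x' : X) (ω : Ω) : g (f x' ω) = objective f g x' ω + g 0 := by
  have h := g.map_vadd 0 (f x' ω)
  simp only [vadd_eq_add, add_zero] at h
  rw [h, linear_eq_sum]
  simp [objective, coords, mul_comm]

lemma integral_objective (hF : IsContGaussian (coords f) Q) (x' : X) :
    ∫ ω, objective f g x' ω ∂Q =
      ∑ k, g.linear (EuclideanSpace.single k 1) * ∫ ω, coords f (x', k) ω ∂Q := by
  simp only [objective, Finset.sum_apply, Pi.smul_apply, smul_eq_mul]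
  rw [integral_finsetSum _ fun k _ =>
    (hF.isGaussianSpace _ (IsContGaussian.mem_span _ _)).integrable.const_mul _]
  simp_rw [integral_const_mul]

lemma integrable_affine (hF : IsContGaussian (coords f) Q) (x' : X) :
    Integrable (fun ω => g (f x' ω)) Q := by
  have := hF.isProbabilityMeasure
  simp_rw [affine_eq_objective]
  exact (hF.isGaussianSpace _ (objective_mem_span g x')).integrable.add (integrable_const _)

lemma integral_affine (hF : IsContGaussian (coords f) Q) (x' : X) :
    ∫ ω, g (f x' ω) ∂Q = ∫ ω, objective f g x' ω ∂Q + g 0 := by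
  have := hF.isProbabilityMeasure
  simp_rw [affine_eq_objective]
  rw [integral_add (hF.isGaussianSpace _ (objective_mem_span g x')).integrable
    (integrable_const _)]
  simp

lemma continuous_integral_objective (hF : IsContGaussian (coords f) Q) :
    Continuous fun x' => ∫ ω, objective f g x' ω ∂Q := by
  simp_rw [integral_objective g hF]
  exact continuous_finsetSum _ fun k _ => (hF.continuous_mean.comp
    (Continuous.prodMk_left k)).const_mul _

lemma continuous_condMean (D : Data X m n) (hF : IsContGaussian (coords f) (posterior Q f Sv D)) :
    Continuous (condMean Q f Sv g D) := by
  unfold condMean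
  simp_rw [integral_affine g hF]
  exact (continuous_integral_objective g hF).add continuous_const

lemma cov_objective (hF : IsContGaussian (coords f) Q) (x' : X) (p : X × Fin m) :
    cov[objective f g x', coords f p; Q] = ∑ k, g.linear (EuclideanSpace.single k 1) *
      cov[coords f (x', k), coords f p; Q] := by
  have := hF.isProbabilityMeasure
  rw [objective, covariance_sum_left
    (fun k => (hF.memLp_two (IsContGaussian.mem_span _ _)).const_smul _)
    (hF.memLp_two (IsContGaussian.mem_span _ _))]
  simp_rw [covariance_smul_left]

/-- After further observations `y` at `x`, the conditional mean of the objective is an affine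
function of `y` that depends continuously on `x`. -/
lemma exists_condMean_extend (hF : IsContGaussian (coords f) Q) (hSvc : Continuous Sv)
    (hSv : ∀ x, (Sv x).PosDef) (D : Data X m n) :
    ∃ (h : (Fin q → X) × X → ℝ) (w : (Fin q → X) × X → Fin q × Fin m → ℝ),
      Continuous h ∧ Continuous w ∧ ∀ x y x', condMean Q f Sv g (D.extend x y) x' =
        h (x, x') + ∑ a, w (x, x') a * y a.1 a.2 := by
  have hF₁ := (posterior_spec hF hSv D).1
  let w : (Fin q → X) × X → Fin q × Fin m → ℝ := fun p => Matrix.vecMul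
    (fun a => cov[objective f g p.2, coords f (p.1 a.1, a.2); posterior Q f Sv D])
    (predCov Q f Sv D p.1)⁻¹
  have hw : Continuous w := by
    refine Continuous.matrix_vecMul (continuous_pi fun a => ?_)
      ((continuous_predCov_inv hSvc hSv D hF₁).comp continuous_fst)
    simp_rw [cov_objective g hF₁]
    refine continuous_finsetSum _ fun k _ => Continuous.const_mul ?_ _
    exact hF₁.continuous_cov.comp
      (f := fun p : (Fin q → X) × X => ((p.2, k), (p.1 a.1, a.2))) (by fun_prop)
  refine ⟨fun p => ∫ ω, objective f g p.2 ω ∂(posterior Q f Sv D) + g 0 -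
    w p ⬝ᵥ postMean Q f Sv D p.1, w, ?_, hw, fun x y x' => ?_⟩
  · exact (((continuous_integral_objective g hF₁).comp continuous_snd).add
      continuous_const).sub (hw.dotProduct ((continuous_postMean D hF₁).comp continuous_fst))
  · rw [condMean, integral_affine g (posterior_spec hF hSv _).1,
      integral_posterior_extend hF hSv D x y (objective_mem_span g x'),
      Matrix.dotProduct_mulVec]
    change _ + w (x, x') ⬝ᵥ _ + _ = _
    simp only [dotProduct, mul_sub, Finset.sum_sub_distrib]
    ring

lemma continuous_bestMean_extend [CompactSpace X] (hF : IsContGaussian (coords f) Q)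
    (hSvc : Continuous Sv) (hSv : ∀ x, (Sv x).PosDef) (D : Data X m n) :
    Continuous fun p : (Fin q → X) × (Fin q → EuclideanSpace ℝ (Fin m)) =>
      bestMean Q f Sv g (D.extend p.1 p.2) := by
  obtain ⟨h, w, hh, hw, hc⟩ := exists_condMean_extend (q := q) g hF hSvc hSv D
  have := isCompact_univ.continuous_sSup (K := (Set.univ : Set X))
    (f := fun (p : (Fin q → X) × (Fin q → EuclideanSpace ℝ (Fin m))) x' =>
      h (p.1, x') + ∑ a, w (p.1, x') a * p.2 a.1 a.2) (by
        refine Continuous.add (hh.comp (by fun_prop)) (continuous_finsetSum _ fun a _ => ?_)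
        exact ((continuous_apply a).comp (hw.comp (by fun_prop))).mul (by fun_prop))
  simpa only [bestMean, hc, Set.image_univ, sSup_range] using this

/-- The coefficients of the affine dependence on `y` are bounded by compactness, so the constant is
uniform in `x`. Linear growth is what provides integrability and the exponential moments later. -/
lemma exists_bestMean_extend_le [CompactSpace X] [Nonempty X]
    (hF : IsContGaussian (coords f) Q) (hSvc : Continuous Sv) (hSv : ∀ x, (Sv x).PosDef)
    (D : Data X m n) :
    ∃ C, 0 ≤ C ∧ ∀ (x : Fin q → X) y,
      |bestMean Q f Sv g (D.extend x y)| ≤ C * (1 + ∑ a : Fin q × Fin m, |y a.1 a.2|) := by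
  obtain ⟨h, w, hh, hw, hc⟩ := exists_condMean_extend (q := q) g hF hSvc hSv D
  obtain ⟨C₁, hC₁⟩ := isCompact_univ.exists_bound_of_continuousOn hh.continuousOn
  obtain ⟨C₂, hC₂⟩ := isCompact_univ.exists_bound_of_continuousOn hw.continuousOn
  refine ⟨max |C₁| |C₂|, by positivity, fun x y => ?_⟩
  have hb : ∀ x', |condMean Q f Sv g (D.extend x y) x'| ≤
      max |C₁| |C₂| * (1 + ∑ a : Fin q × Fin m, |y a.1 a.2|) := by
    intro x'
    rw [hc, mul_add, mul_one, Finset.mul_sum]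
    refine (abs_add_le _ _).trans (add_le_add
      (((hC₁ _ (Set.mem_univ _)).trans (le_abs_self _)).trans (le_max_left _ _))
      ((Finset.abs_sum_le_sum_abs _ _).trans (Finset.sum_le_sum fun a _ => ?_)))
    rw [abs_mul]
    exact mul_le_mul_of_nonneg_right (((norm_le_pi_norm (w (x, x')) a).trans
      (hC₂ _ (Set.mem_univ _))).trans ((le_abs_self _).trans (le_max_right _ _))) (abs_nonneg _)
  have hbdd : BddAbove (Set.range (condMean Q f Sv g (D.extend x y))) :=
    ⟨_, Set.forall_mem_range.mpr fun x' => (abs_le.mp (hb x')).2⟩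
  have x₀ : X := Classical.arbitrary X
  exact abs_le.mpr ⟨(abs_le.mp (hb x₀)).1.trans (le_ciSup hbdd x₀),
    ciSup_le fun x' => (abs_le.mp (hb x')).2⟩

end BestMean

/-! ### Reparameterization of the predictive law. -/

section Predictive

variable {d m n q s : ℕ} {X : Set (EuclideanSpace ℝ (Fin d))} {Ω : Type*} [MeasurableSpace Ω]
  {Q : Measure Ω} {f : X → Ω → EuclideanSpace ℝ (Fin m)} {Sv : X → Matrix (Fin m) (Fin m) ℝ}

lemma aemeasurable_of_coords (hF : IsContGaussian (coords f) Q) (x : X) :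
    AEMeasurable (f x) Q :=
  (WithLp.measurable_toLp 2 _).comp_aemeasurable (aemeasurable_pi_lambda _ fun k =>
    (hF.isGaussianSpace _ (IsContGaussian.mem_span (coords f) (x, k))).aemeasurable)

lemma dual_eq_sum (ℓ : StrongDual ℝ (Fin q → EuclideanSpace ℝ (Fin m))) :
    ∃ c : Fin q × Fin m → ℝ, ∀ y, ℓ y = ∑ j, ∑ k, c (j, k) * y j k := by
  refine ⟨fun a => ℓ (Pi.single a.1 (EuclideanSpace.single a.2 1)), fun y => ?_⟩
  have h : ℓ y = ∑ j, (ℓ.toLinearMap.comp (LinearMap.single ℝ _ j)) (y j) := by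
    conv_lhs => rw [← Finset.univ_sum_single y]
    simp
  rw [h]
  refine Finset.sum_congr rfl fun j _ => ?_
  rw [linear_eq_sum]
  simp [mul_comm]

lemma continuous_fantasy (D : Data X m n) (L : (Fin q → X) → Matrix (Fin q × Fin m) (Fin s) ℝ)
    (x : Fin q → X) : Continuous (fantasy Q f Sv D L x) := by
  unfold fantasy
  refine continuous_pi fun j => (PiLp.continuous_toLp 2 _).comp (continuous_pi fun k => ?_)
  exact continuous_const.add ((continuous_apply (j, k)).comp
    (Continuous.matrix_mulVec continuous_const continuous_id))

/-- The reparameterized observations have the predictive law. -/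
lemma predictive_eq_map_fantasy (D : Data X m n)
    (hF : IsContGaussian (coords f) (posterior Q f Sv D)) (hSv : ∀ x, (Sv x).PosDef)
    (L : (Fin q → X) → Matrix (Fin q × Fin m) (Fin s) ℝ) (x : Fin q → X)
    (hL : L x * (L x).transpose = predCov Q f Sv D x) :
    predictive Q f Sv D x =
      (Measure.pi fun _ : Fin s => gaussianReal 0 1).map (fantasy Q f Sv D L x) := by
  have := hF.isProbabilityMeasure
  have hm : AEMeasurable (fun (p : Ω × (Fin q → EuclideanSpace ℝ (Fin m))) j =>
      f (x j) p.1 + p.2 j) ((posterior Q f Sv D).prod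
        (Measure.pi fun j => multivariateGaussian 0 (Sv (x j)))) :=
    aemeasurable_pi_lambda _ fun j => (aemeasurable_of_coords hF (x j)).comp_fst.add
      (by fun_prop)
  have hm' := (continuous_fantasy (Q := Q) (f := f) (Sv := Sv) D L x).measurable
  have := Measure.isProbabilityMeasure_map hm
  have := Measure.isProbabilityMeasure_map
    (μ := Measure.pi fun _ : Fin s => gaussianReal 0 1) hm'.aemeasurable
  rw [predictive]
  refine Measure.ext_of_charFunDual (funext fun ℓ => ?_)
  rw [charFunDual_apply, charFunDual_apply, integral_map hm (by fun_prop),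
    integral_map hm'.aemeasurable (by fun_prop)]
  obtain ⟨c, hc⟩ := dual_eq_sum ℓ
  have hmem : ∑ a : Fin q × Fin m, c a • coords f (x a.1, a.2) ∈
      Submodule.span ℝ (Set.range (coords f)) :=
    Submodule.sum_mem _ fun _ _ => Submodule.smul_mem _ _ (IsContGaussian.mem_span _ _)
  have hmean : ∫ ω, (∑ a : Fin q × Fin m, c a • coords f (x a.1, a.2)) ω ∂(posterior Q f Sv D) =
      ∑ a, c a * postMean Q f Sv D x a := by
    simp only [Finset.sum_apply, Pi.smul_apply, smul_eq_mul]
    rw [integral_finsetSum _ fun a _ =>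
      (hF.isGaussianSpace _ (IsContGaussian.mem_span _ _)).integrable.const_mul _]
    simp_rw [integral_const_mul]
    rfl
  -- Both characteristic functions are exp(i c·μ - cᵀΣc/2), with Σ the predictive covariance. One
  -- side sees cᵀΣc as process variance plus noise, the other as the squared length of cᵀL.
  have hquad := dotProduct_predCov_mulVec D x hF c
  have hquad' : c ⬝ᵥ (predCov Q f Sv D x).mulVec c =
      ∑ i, (∑ a, c a * L x a i) ^ 2 := by
    rw [← hL, ← Matrix.mulVec_mulVec, Matrix.dotProduct_mulVec, Matrix.mulVec_transpose]
    simp only [dotProduct, Matrix.vecMul, pow_two]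
  have h1 : ∀ p : Ω × (Fin q → EuclideanSpace ℝ (Fin m)),
      Complex.exp (ℓ (fun j => f (x j) p.1 + p.2 j) * Complex.I) =
      Complex.exp ((∑ a : Fin q × Fin m, c a • coords f (x a.1, a.2)) p.1 * Complex.I) *
        ∏ j, Complex.exp (inner ℝ (p.2 j) (WithLp.toLp 2 fun k => c (j, k)) * Complex.I) := by
    intro p
    rw [← Complex.exp_sum, ← Complex.exp_add, ← Finset.sum_mul, ← add_mul, hc]
    congr 2
    norm_cast
    simp only [PiLp.add_apply, mul_add, Finset.sum_add_distrib, Finset.sum_apply, Pi.smul_apply,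
      smul_eq_mul, Fintype.sum_prod_type, coords, PiLp.inner_apply]
    simp
  have h2 : ∀ e : Fin s → ℝ, Complex.exp (ℓ (fantasy Q f Sv D L x e) * Complex.I) =
      Complex.exp ((∑ a, c a * postMean Q f Sv D x a : ℝ) * Complex.I) *
        ∏ i, Complex.exp ((∑ a, c a * L x a i : ℝ) * e i * Complex.I) := by
    intro e
    rw [← Complex.exp_sum, ← Complex.exp_add, ← Finset.sum_mul, ← add_mul, hc]
    congr 2
    norm_cast
    simp only [fantasy, mul_add, Finset.sum_add_distrib]
    rw [← Fintype.sum_prod_type (f := fun a => c a * postMean Q f Sv D x a),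
      ← Fintype.sum_prod_type (f := fun a => c a * (L x).mulVec e a)]
    congr 1
    simp only [Matrix.mulVec, dotProduct, Finset.mul_sum, Finset.sum_mul]
    rw [Finset.sum_comm]
    simp only [mul_assoc]
  simp_rw [h1, h2]
  rw [integral_prod_mul (fun ω => Complex.exp ((∑ a : Fin q × Fin m,
      c a • coords f (x a.1, a.2)) ω * Complex.I)) (fun v : Fin q → EuclideanSpace ℝ (Fin m) => ∏ j, Complex.exp
      (inner ℝ (v j) (WithLp.toLp 2 fun k => c (j, k)) * Complex.I)),
    integral_const_mul, integral_cexp_of_hasGaussianLaw (hF.isGaussianSpace _ hmem), hmean,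
    integral_fintype_prod_eq_prod (fun j (v : EuclideanSpace ℝ (Fin m)) => Complex.exp
      (inner ℝ v (WithLp.toLp 2 fun k => c (j, k)) * Complex.I)),
    integral_fintype_prod_eq_prod (fun i (t : ℝ) => Complex.exp
      ((∑ a, c a * L x a i : ℝ) * t * Complex.I))]
  have h3 : ∀ j, ∫ v, Complex.exp (inner ℝ v (WithLp.toLp 2 fun k => c (j, k)) * Complex.I)
      ∂(multivariateGaussian 0 (Sv (x j))) =
      Complex.exp (-((fun k => c (j, k)) ⬝ᵥ (Sv (x j)).mulVec fun k => c (j, k) : ℝ) / 2) := by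
    intro j
    rw [← charFun_apply, charFun_multivariateGaussian (hSv (x j)).posSemidef]
    simp [neg_div]
  have h4 : ∀ i, ∫ t, Complex.exp ((∑ a, c a * L x a i : ℝ) * t * Complex.I)
      ∂(gaussianReal 0 1) = Complex.exp (-((∑ a, c a * L x a i) ^ 2 : ℝ) / 2) := by
    intro i
    rw [← charFun_apply_real, charFun_gaussianReal]
    simp [neg_div]
  simp_rw [h3, h4]
  rw [← Complex.exp_sum, ← Complex.exp_sum, ← Complex.exp_add, ← Complex.exp_add]
  congr 1
  rw [hquad'] at hquad
  rw [← Finset.sum_div, ← Finset.sum_div, Finset.sum_neg_distrib, Finset.sum_neg_distrib,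
    ← Complex.ofReal_sum, ← Complex.ofReal_sum, hquad]
  push_cast
  ring

end Predictive

/-! ### Stability of suprema and maximizers. -/

section Maximizers

variable {Y Ω' : Type*} [MeasurableSpace Ω'] {P' : Measure Ω'}

lemma argmax_nonempty_of_continuous [TopologicalSpace Y] [CompactSpace Y] [Nonempty Y] {F : Y → ℝ}
    (hF : Continuous F) : (argmax F).Nonempty := by
  obtain ⟨x, -, hx⟩ := isCompact_univ.exists_isMaxOn Set.univ_nonempty hF.continuousOn
  exact ⟨x, fun z => hx (Set.mem_univ z)⟩

/-- If random functions converge to `F` uniformly at an exponential rate, so do their suprema. -/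
lemma ae_tendsto_iSup_of_expSmall [TopologicalSpace Y] [CompactSpace Y] [Nonempty Y] {F : Y → ℝ}
    (hF : Continuous F) {G : ℕ → Ω' → Y → ℝ} (hG : ∀ N ω, BddAbove (Set.range (G N ω)))
    (h : ∀ η > 0, ExpSmall P' fun N => {ω | ∃ x, η < |G N ω x - F x|}) :
    ∀ᵐ ω ∂P', Tendsto (fun N => ⨆ x, G N ω x) atTop (𝓝 (⨆ x, F x)) := by
  have hae : ∀ᵐ ω ∂P', ∀ k : ℕ, ∀ᶠ N in atTop, ω ∉ {ω | ∃ x, 1 / ((k : ℝ) + 1) <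
      |G N ω x - F x|} := ae_all_iff.mpr fun k => (h _ (by positivity)).ae_eventually_notMem
  filter_upwards [hae] with ω hω
  refine Metric.tendsto_atTop'.mpr fun η hη => ?_
  obtain ⟨k, hk⟩ := exists_nat_one_div_lt hη
  obtain ⟨N₀, hN₀⟩ := eventually_atTop.mp (hω k)
  refine ⟨N₀, fun N hN => lt_of_le_of_lt ?_ hk⟩
  have hx : ∀ x, |G N ω x - F x| ≤ 1 / ((k : ℝ) + 1) := by
    simpa using hN₀ N hN.le
  have hFb : BddAbove (Set.range F) := (isCompact_range hF).bddAbove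
  rw [Real.dist_eq, abs_le]
  constructor
  · have : (⨆ x, F x) ≤ (⨆ x, G N ω x) + 1 / ((k : ℝ) + 1) := ciSup_le fun x => by
      linarith [le_ciSup (hG N ω) x, (abs_le.mp (hx x)).1]
    linarith
  · have : (⨆ x, G N ω x) ≤ (⨆ x, F x) + 1 / ((k : ℝ) + 1) := ciSup_le fun x => by
      linarith [le_ciSup hFb x, (abs_le.mp (hx x)).2]
    linarith

/-- If random functions converge to `F` uniformly at an exponential rate, their maximizers converge
to those of `F` at an exponential rate. -/
lemma expSmall_infDist_argmax [PseudoMetricSpace Y] [CompactSpace Y] [Nonempty Y] {F : Y → ℝ}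
    (hF : Continuous F) {G : ℕ → Ω' → Y → ℝ}
    (h : ∀ η > 0, ExpSmall P' fun N => {ω | ∃ x, η < |G N ω x - F x|}) {δ : ℝ} (hδ : 0 < δ) :
    ExpSmall P' fun N => {ω | ∃ x ∈ argmax (G N ω), δ < Metric.infDist x (argmax F)} := by
  -- The non-strict inequality makes `S` closed, hence compact, so `F` attains its maximum over `S`,
  -- strictly below the global one.
  let S : Set Y := {x | δ ≤ Metric.infDist x (argmax F)}
  have hS : IsClosed S := isClosed_le continuous_const (Metric.continuous_infDist_pt _)
  obtain ⟨x₀, hx₀⟩ := argmax_nonempty_of_continuous hF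
  rcases S.eq_empty_or_nonempty with hemp | hne
  · refine ExpSmall.empty.mono fun N _ ω ⟨x, _, hx⟩ => ?_
    exact (hemp ▸ (show x ∈ S from hx.le) : x ∈ (∅ : Set Y))
  obtain ⟨x₁, hx₁S, hx₁⟩ := hS.isCompact.exists_isMaxOn hne hF.continuousOn
  have hgap : F x₁ < F x₀ := by
    refine lt_of_not_ge fun hle => ?_
    have hmem : x₁ ∈ argmax F := fun z => (hx₀ z).trans hle
    have : δ ≤ Metric.infDist x₁ (argmax F) := hx₁S
    rw [Metric.infDist_zero_of_mem hmem] at this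
    exact this.not_gt hδ
  -- An error of a third of the gap is incurred twice, at `x` and at `x₀`, and still cannot close
  -- the gap.
  refine (h ((F x₀ - F x₁) / 3) (by linarith)).mono fun N _ ω ⟨x, hx, hxδ⟩ => ?_
  by_contra hcon
  have hc : ∀ z, |G N ω z - F z| ≤ (F x₀ - F x₁) / 3 := by simpa using hcon
  have h1 : F x ≤ F x₁ := hx₁ (show x ∈ S from hxδ.le)
  linarith [hx x₀, (abs_le.mp (hc x)).2, (abs_le.mp (hc x₀)).1]

end Maximizers

/-! ### The Knowledge Gradient and its sample average approximation. -/

section KnowledgeGradient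

variable {d m n q s : ℕ} {X : Set (EuclideanSpace ℝ (Fin d))} {Ω : Type*} [MeasurableSpace Ω]
  {Q : Measure Ω} {f : X → Ω → EuclideanSpace ℝ (Fin m)} {Sv : X → Matrix (Fin m) (Fin m) ℝ}

/-- The candidate sets together with a root of the covariance matrix of their observations. -/
def roots (s : ℕ) (Q : Measure Ω) (f : X → Ω → EuclideanSpace ℝ (Fin m))
    (Sv : X → Matrix (Fin m) (Fin m) ℝ) (D : Data X m n) :
    Set ((Fin q → X) × (Fin q × Fin m → Fin s → ℝ)) :=
  {p | Matrix.of p.2 * (Matrix.of p.2).transpose = predCov Q f Sv D p.1}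

/-- The squared entries in a row of a root sum to a diagonal entry of the covariance, which is
bounded over the compact candidate space. -/
lemma exists_abs_root_le [CompactSpace X] (hSvc : Continuous Sv) (D : Data X m n)
    (hF : IsContGaussian (coords f) (posterior Q f Sv D)) :
    ∃ M, 0 ≤ M ∧ ∀ p ∈ roots (q := q) s Q f Sv D, ∀ a i, |p.2 a i| ≤ M := by
  have hc := continuous_predCov (q := q) hSvc D hF
  have hb : ∀ a, ∃ M, ∀ x, |predCov Q f Sv D x a a| ≤ M := fun a => by
    obtain ⟨M, hM⟩ := isCompact_univ.exists_bound_of_continuousOn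
      (hc.matrix_elem a a).continuousOn
    exact ⟨M, fun x => hM x (Set.mem_univ x)⟩
  choose M hM using hb
  -- The added 1 allows t² ≤ S to give |t| ≤ S + 1 without a square root.
  refine ⟨∑ a, |M a| + 1, by positivity, fun p hp a i => ?_⟩
  have h1 : p.2 a i ^ 2 ≤ predCov Q f Sv D p.1 a a := by
    rw [← show _ = predCov Q f Sv D p.1 from hp, Matrix.mul_apply]
    simp only [Matrix.transpose_apply, Matrix.of_apply, ← pow_two]
    exact Finset.single_le_sum (f := fun i => p.2 a i ^ 2) (fun i _ => sq_nonneg _)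
      (Finset.mem_univ i)
  have h2 : p.2 a i ^ 2 ≤ ∑ a, |M a| :=
    h1.trans ((le_abs_self _).trans ((hM a p.1).trans ((le_abs_self _).trans
      (Finset.single_le_sum (f := fun a => |M a|) (fun a _ => abs_nonneg _)
        (Finset.mem_univ a)))))
  refine abs_le_of_sq_le_sq (h2.trans ?_) (by positivity)
  have : 0 ≤ ∑ a, |M a| := by positivity
  nlinarith

/-- This compactness stands in for continuity of `L`: the graph of any choice of roots lies in
`roots`. -/
lemma isCompact_roots [CompactSpace X] (hSvc : Continuous Sv) (D : Data X m n)
    (hF : IsContGaussian (coords f) (posterior Q f Sv D)) :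
    IsCompact (roots (q := q) s Q f Sv D) := by
  obtain ⟨M, -, hM⟩ := exists_abs_root_le (q := q) (s := s) hSvc D hF
  have hcl : IsClosed (roots (q := q) s Q f Sv D) := by
    have h : Continuous fun p : (Fin q → X) × (Fin q × Fin m → Fin s → ℝ) => Matrix.of p.2 :=
      continuous_snd
    exact isClosed_eq (h.matrix_mul h.matrix_transpose)
      ((continuous_predCov hSvc D hF).comp continuous_fst)
  refine (isCompact_univ.prod (isCompact_univ_pi fun _ => isCompact_univ_pi fun _ =>
    isCompact_Icc (a := -M) (b := M))).of_isClosed_subset hcl fun p hp =>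
      ⟨Set.mem_univ _, fun a _ i _ => abs_le.mp (hM p hp a i)⟩

/-- The optimal conditional mean after the fantasy observation with base sample `e`, as a function
of the candidate set and of the root. -/
noncomputable def fantasyMean (Q : Measure Ω) (f : X → Ω → EuclideanSpace ℝ (Fin m))
    (Sv : X → Matrix (Fin m) (Fin m) ℝ) (g : EuclideanSpace ℝ (Fin m) →ᵃ[ℝ] ℝ) (D : Data X m n)
    (p : (Fin q → X) × (Fin q × Fin m → Fin s → ℝ)) (e : Fin s → ℝ) : ℝ :=
  bestMean Q f Sv g (D.extend p.1 (fantasy Q f Sv D (fun _ => Matrix.of p.2) p.1 e))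

variable (g : EuclideanSpace ℝ (Fin m) →ᵃ[ℝ] ℝ)

lemma continuous_fantasyMean [CompactSpace X] (hF : IsContGaussian (coords f) Q)
    (hSvc : Continuous Sv) (hSv : ∀ x, (Sv x).PosDef) (D : Data X m n) :
    Continuous fun p : ((Fin q → X) × (Fin q × Fin m → Fin s → ℝ)) × (Fin s → ℝ) =>
      fantasyMean Q f Sv g D p.1 p.2 := by
  have hF₁ := (posterior_spec hF hSv D).1
  refine (continuous_bestMean_extend g hF hSvc hSv D).comp
    (f := fun p : ((Fin q → X) × (Fin q × Fin m → Fin s → ℝ)) × (Fin s → ℝ) =>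
      (p.1.1, fantasy Q f Sv D (fun _ => Matrix.of p.1.2) p.1.1 p.2))
    (Continuous.prodMk (by fun_prop) ?_)
  unfold fantasy
  refine continuous_pi fun j => (PiLp.continuous_toLp 2 _).comp (continuous_pi fun k => ?_)
  refine Continuous.add ?_ ?_
  · exact (continuous_apply (j, k)).comp ((continuous_postMean D hF₁).comp (by fun_prop))
  · simp only [Matrix.mulVec, dotProduct, Matrix.of_apply]
    fun_prop

lemma exists_fantasyMean_le [CompactSpace X] [Nonempty X] (hF : IsContGaussian (coords f) Q)
    (hSvc : Continuous Sv) (hSv : ∀ x, (Sv x).PosDef) (D : Data X m n) :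
    ∃ C, 0 ≤ C ∧ ∀ p ∈ roots (q := q) s Q f Sv D, ∀ e,
      |fantasyMean Q f Sv g D p e| ≤ C * (1 + ‖e‖) := by
  have hF₁ := (posterior_spec hF hSv D).1
  obtain ⟨C, hC0, hC⟩ := exists_bestMean_extend_le (q := q) g hF hSvc hSv D
  obtain ⟨M, hM0, hM⟩ := exists_abs_root_le (q := q) (s := s) hSvc D hF₁
  obtain ⟨B, hB⟩ := isCompact_univ.exists_bound_of_continuousOn
    (continuous_postMean (q := q) D hF₁).continuousOn
  refine ⟨C * (1 + Fintype.card (Fin q × Fin m) * (|B| + s * M)), by positivity,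
    fun p hp e => ?_⟩
  have hy : ∀ a : Fin q × Fin m, |fantasy Q f Sv D (fun _ => Matrix.of p.2) p.1 e a.1 a.2| ≤
      |B| + s * M * ‖e‖ := by
    intro a
    have h1 : |postMean Q f Sv D p.1 a| ≤ |B| :=
      ((norm_le_pi_norm (postMean Q f Sv D p.1) a).trans (hB _ (Set.mem_univ _))).trans
        (le_abs_self _)
    have h2 : |∑ i, p.2 a i * e i| ≤ s * M * ‖e‖ := by
      refine (Finset.abs_sum_le_sum_abs _ _).trans ((Finset.sum_le_card_nsmul _ _ (M * ‖e‖)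
        fun i _ => ?_).trans_eq ?_)
      · rw [abs_mul]
        exact mul_le_mul (hM p hp a i) (norm_le_pi_norm e i) (abs_nonneg _) hM0
      · rw [Finset.card_univ, Fintype.card_fin, nsmul_eq_mul, mul_assoc]
    exact (abs_add_le _ _).trans (add_le_add h1 h2)
  have hsum := Finset.sum_le_card_nsmul Finset.univ _ _ fun a _ => hy a
  rw [Finset.card_univ, nsmul_eq_mul] at hsum
  have he := norm_nonneg e
  have h0 : (0 : ℝ) ≤ s * M := by positivity
  calc |fantasyMean Q f Sv g D p e|
      ≤ C * (1 + Fintype.card (Fin q × Fin m) * (|B| + s * M * ‖e‖)) :=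
        (hC _ _).trans (by gcongr)
    _ ≤ C * ((1 + Fintype.card (Fin q × Fin m) * (|B| + s * M)) * (1 + ‖e‖)) := by
      gcongr
      have h3 : (0 : ℝ) ≤ Fintype.card (Fin q × Fin m) := by positivity
      nlinarith [mul_nonneg h3 h0, mul_nonneg (mul_nonneg h3 (abs_nonneg B)) he]
    _ = _ := by ring

/-- Fernique's theorem makes some exp(C‖e‖²) integrable, and completing the square bounds t‖e‖ by
C‖e‖² + t²/(4C). -/
lemma integrable_exp_mul_norm_pi_gaussianReal (t : ℝ) :
    Integrable (fun e : Fin s → ℝ => Real.exp (t * ‖e‖))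
      (Measure.pi fun _ : Fin s => gaussianReal 0 1) := by
  have hg : HasGaussianLaw (fun (e : Fin s → ℝ) i => e i)
      (Measure.pi fun _ : Fin s => gaussianReal 0 1) :=
    iIndepFun.hasGaussianLaw (X := fun i (e : Fin s → ℝ) => e i)
      (fun i => ⟨by
        rw [(measurePreserving_eval (fun _ : Fin s => gaussianReal 0 1) i).map_eq]
        infer_instance⟩)
      (iIndepFun_pi (X := fun _ => id) fun _ => aemeasurable_id)
  have : IsGaussian (Measure.pi fun _ : Fin s => gaussianReal 0 1) := by
    simpa using hg.isGaussian_map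
  obtain ⟨C, hC, h⟩ := IsGaussian.exists_integrable_exp_sq
    (Measure.pi fun _ : Fin s => gaussianReal 0 1)
  refine (h.const_mul (Real.exp (t ^ 2 / (4 * C)))).mono' (by fun_prop) (ae_of_all _ fun e => ?_)
  rw [Real.norm_of_nonneg (Real.exp_nonneg _), ← Real.exp_add, Real.exp_le_exp]
  have : t ^ 2 / (4 * C) + C * ‖e‖ ^ 2 - t * ‖e‖ = (t - 2 * C * ‖e‖) ^ 2 / (4 * C) := by
    field_simp
    ring
  have h2 : 0 ≤ (t - 2 * C * ‖e‖) ^ 2 / (4 * C) := by positivity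
  linarith

lemma continuous_bestMean_extend_right [CompactSpace X] (hF : IsContGaussian (coords f) Q)
    (hSvc : Continuous Sv) (hSv : ∀ x, (Sv x).PosDef) (D : Data X m n) (x : Fin q → X) :
    Continuous fun y => bestMean Q f Sv g (D.extend x y) := by
  have h := continuous_bestMean_extend (q := q) g hF hSvc hSv D
  exact h.comp (f := fun y => (x, y)) (Continuous.prodMk_right x)

lemma continuous_fantasyMean_right [CompactSpace X] (hF : IsContGaussian (coords f) Q)
    (hSvc : Continuous Sv) (hSv : ∀ x, (Sv x).PosDef) (D : Data X m n)
    (p : (Fin q → X) × (Fin q × Fin m → Fin s → ℝ)) :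
    Continuous (fantasyMean Q f Sv g D p) := by
  have h := continuous_fantasyMean (q := q) (s := s) g hF hSvc hSv D
  exact h.comp (f := fun e => (p, e)) (Continuous.prodMk_right p)

lemma continuous_fantasyMean_left [CompactSpace X] (hF : IsContGaussian (coords f) Q)
    (hSvc : Continuous Sv) (hSv : ∀ x, (Sv x).PosDef) (D : Data X m n) (e : Fin s → ℝ) :
    Continuous fun p : (Fin q → X) × (Fin q × Fin m → Fin s → ℝ) =>
      fantasyMean Q f Sv g D p e := by
  have h := continuous_fantasyMean (q := q) (s := s) g hF hSvc hSv D
  exact h.comp (f := fun p => (p, e)) (Continuous.prodMk_left e)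

lemma integrable_fantasyMean [CompactSpace X] [Nonempty X] (hF : IsContGaussian (coords f) Q)
    (hSvc : Continuous Sv) (hSv : ∀ x, (Sv x).PosDef) (D : Data X m n)
    {p : (Fin q → X) × (Fin q × Fin m → Fin s → ℝ)} (hp : p ∈ roots s Q f Sv D) :
    Integrable (fantasyMean Q f Sv g D p) (Measure.pi fun _ : Fin s => gaussianReal 0 1) := by
  obtain ⟨C, -, hC⟩ := exists_fantasyMean_le (q := q) (s := s) g hF hSvc hSv D
  have h := (continuous_fantasyMean_right g hF hSvc hSv D p).measurable
  exact integrable_of_abs_le integrable_exp_mul_norm_pi_gaussianReal h (hC p hp)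

lemma integrable_bestMean_extend [CompactSpace X] [Nonempty X] (hF : IsContGaussian (coords f) Q)
    (hSvc : Continuous Sv) (hSv : ∀ x, (Sv x).PosDef) (D : Data X m n) {x : Fin q → X}
    {M : Fin q × Fin m → Fin s → ℝ} (hM : (x, M) ∈ roots s Q f Sv D) :
    Integrable (fun y => bestMean Q f Sv g (D.extend x y)) (predictive Q f Sv D x) := by
  have hF₁ := (posterior_spec hF hSv D).1
  have hb := continuous_bestMean_extend_right (q := q) g hF hSvc hSv D x
  rw [predictive_eq_map_fantasy D hF₁ hSv (fun _ => Matrix.of M) x hM,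
    integrable_map_measure hb.measurable.aestronglyMeasurable
      (continuous_fantasy D _ x).measurable.aemeasurable]
  exact integrable_fantasyMean (p := (x, M)) g hF hSvc hSv D hM

/-- Since `M` is absent from the left side, the integral is the same for all roots over `x`. -/
lemma alphaKG_eq_integral [CompactSpace X] (hF : IsContGaussian (coords f) Q)
    (hSvc : Continuous Sv) (hSv : ∀ x, (Sv x).PosDef) (D : Data X m n) {x : Fin q → X}
    {M : Fin q × Fin m → Fin s → ℝ} (hM : (x, M) ∈ roots s Q f Sv D) :
    alphaKG Q f Sv g D x = ∫ e, fantasyMean Q f Sv g D (x, M) e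
      ∂(Measure.pi fun _ : Fin s => gaussianReal 0 1) - bestMean Q f Sv g D := by
  have hF₁ := (posterior_spec hF hSv D).1
  have hb := continuous_bestMean_extend_right (q := q) g hF hSvc hSv D x
  rw [alphaKG, predictive_eq_map_fantasy D hF₁ hSv (fun _ => Matrix.of M) x hM,
    integral_map (continuous_fantasy D _ x).measurable.aemeasurable
      hb.measurable.aestronglyMeasurable]
  rfl

/-- The Knowledge Gradient is continuous, as the roots depend on the candidate set through a
compact correspondence. -/
lemma continuous_alphaKG [CompactSpace X] [Nonempty X] (hF : IsContGaussian (coords f) Q)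
    (hSvc : Continuous Sv) (hSv : ∀ x, (Sv x).PosDef) (D : Data X m n)
    (hsurj : ∀ x : Fin q → X, ∃ M, (x, M) ∈ roots s Q f Sv D) :
    Continuous (alphaKG (q := q) Q f Sv g D) := by
  have hF₁ := (posterior_spec hF hSv D).1
  have : CompactSpace (roots (q := q) s Q f Sv D) :=
    isCompact_iff_compactSpace.mp (isCompact_roots hSvc D hF₁)
  let π : roots (q := q) s Q f Sv D → (Fin q → X) := fun p => p.1.1
  have hπ : Continuous π := by fun_prop
  -- A continuous surjection from a compact space to a Hausdorff one is a quotient map, so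
  -- continuity can be checked on `roots`, where dominated convergence applies.
  have hquot : IsQuotientMap π := hπ.isClosedMap.isQuotientMap hπ fun x => by
    obtain ⟨M, hM⟩ := hsurj x
    exact ⟨⟨_, hM⟩, rfl⟩
  rw [hquot.continuous_iff]
  obtain ⟨C, -, hC⟩ := exists_fantasyMean_le (q := q) (s := s) g hF hSvc hSv D
  have heq : alphaKG Q f Sv g D ∘ π = fun p => ∫ e, fantasyMean Q f Sv g D p.1 e
      ∂(Measure.pi fun _ : Fin s => gaussianReal 0 1) - bestMean Q f Sv g D :=
    funext fun p => alphaKG_eq_integral g hF hSvc hSv D p.2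
  rw [heq]
  refine Continuous.sub ?_ continuous_const
  refine continuous_of_dominated (bound := fun e => C * (1 + ‖e‖))
    (fun p => (continuous_fantasyMean_right g hF hSvc hSv D
      p.1).measurable.aestronglyMeasurable)
    (fun p => ae_of_all _ (hC p.1 p.2))
    (integrable_of_abs_le (C := |C|) integrable_exp_mul_norm_pi_gaussianReal (by fun_prop)
      fun e => ?_)
    (ae_of_all _ fun e => ?_)
  swap
  · exact (continuous_fantasyMean_left g hF hSvc hSv D e).comp continuous_subtype_val
  rw [abs_mul, abs_of_nonneg (by positivity : 0 ≤ 1 + ‖e‖)]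

/-- The uniform law holds over all of `roots`, in particular at the points `(x, L x)`; no regularity
of `L` enters. -/
lemma expSmall_alphaHat_sub_alphaKG [CompactSpace X] [Nonempty X]
    (hF : IsContGaussian (coords f) Q) (hSvc : Continuous Sv) (hSv : ∀ x, (Sv x).PosDef)
    (D : Data X m n) {L : (Fin q → X) → Matrix (Fin q × Fin m) (Fin s) ℝ}
    (hL : ∀ x, L x * (L x).transpose = predCov Q f Sv D x)
    {Ω' : Type*} [MeasurableSpace Ω'] {P' : Measure Ω'} [IsProbabilityMeasure P']
    {ε : ℕ → Ω' → Fin s → ℝ}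
    (hlaw : ∀ i, HasLaw (ε i) (Measure.pi fun _ : Fin s => gaussianReal 0 1) P')
    (hind : iIndepFun ε P') {η : ℝ} (hη : 0 < η) :
    ExpSmall P' fun N => {ω | ∃ x,
      η < |alphaHat Q f Sv g D L (fun i => ε i ω) N x - alphaKG Q f Sv g D x|} := by
  have hF₁ := (posterior_spec hF hSv D).1
  have : CompactSpace (roots (q := q) s Q f Sv D) :=
    isCompact_iff_compactSpace.mp (isCompact_roots hSvc D hF₁)
  obtain ⟨C, hC0, hC⟩ := exists_fantasyMean_le (q := q) (s := s) g hF hSvc hSv D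
  have hc := continuous_fantasyMean (q := q) (s := s) g hF hSvc hSv D
  have hc' : Continuous fun p : roots (q := q) s Q f Sv D × (Fin s → ℝ) =>
      fantasyMean Q f Sv g D p.1.1 p.2 :=
    hc.comp (f := fun p : roots (q := q) s Q f Sv D × (Fin s → ℝ) => (p.1.1, p.2))
      (by fun_prop)
  refine (expSmall_uniform hlaw hind integrable_exp_mul_norm_pi_gaussianReal
    (H := fun p : roots (q := q) s Q f Sv D => fantasyMean Q f Sv g D p.1)
    hc' hC0 (fun p => hC p.1 p.2) hη).mono fun N _ ω ⟨x, hx⟩ => ?_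
  refine ⟨⟨(x, L x), hL x⟩, ?_⟩
  rw [alphaKG_eq_integral g hF hSvc hSv D (hL x), alphaHat, sub_sub_sub_cancel_right] at hx
  exact hx

lemma bddAbove_range_alphaHat [CompactSpace X] [Nonempty X]
    (hF : IsContGaussian (coords f) Q) (hSvc : Continuous Sv) (hSv : ∀ x, (Sv x).PosDef)
    (D : Data X m n) {L : (Fin q → X) → Matrix (Fin q × Fin m) (Fin s) ℝ}
    (hL : ∀ x, L x * (L x).transpose = predCov Q f Sv D x) (e : ℕ → Fin s → ℝ) (N : ℕ) :
    BddAbove (Set.range (alphaHat Q f Sv g D L e N)) := by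
  obtain ⟨C, hC0, hC⟩ := exists_fantasyMean_le (q := q) (s := s) g hF hSvc hSv D
  refine ⟨1 / (N : ℝ) * ∑ i ∈ Finset.range N, C * (1 + ‖e i‖) - bestMean Q f Sv g D, ?_⟩
  rintro _ ⟨x, rfl⟩
  rw [alphaHat]
  gcongr with i
  exact (le_abs_self _).trans (hC (x, L x) (hL x) (e i))

lemma continuous_alphaHat [CompactSpace X]
    (hF : IsContGaussian (coords f) Q) (hSvc : Continuous Sv) (hSv : ∀ x, (Sv x).PosDef)
    (D : Data X m n) {L : (Fin q → X) → Matrix (Fin q × Fin m) (Fin s) ℝ}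
    (hL : Continuous L) (e : ℕ → Fin s → ℝ) (N : ℕ) :
    Continuous (alphaHat Q f Sv g D L e N) := by
  refine Continuous.sub (continuous_const.mul (continuous_finsetSum _ fun i _ => ?_))
    continuous_const
  exact (continuous_fantasyMean (q := q) (s := s) g hF hSvc hSv D).comp
    (f := fun x => ((x, L x), e i)) ((continuous_id.prodMk hL).prodMk continuous_const)

end KnowledgeGradient

end KG

/-! ### The main theorem. -/

theorem theorem2 {d m n q s : ℕ}
    -- the design space: a non-empty compact set
    (X : Set (EuclideanSpace ℝ (Fin d))) (hX : IsCompact X) (hXne : X.Nonempty)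
    -- the Gaussian process prior, with continuously differentiable mean and covariance functions
    {Ω : Type*} [MeasurableSpace Ω] (P : Measure Ω) [IsProbabilityMeasure P]
    (f : X → Ω → EuclideanSpace ℝ (Fin m)) (hf : IsGaussianProcess f P)
    (μ₀ : EuclideanSpace ℝ (Fin d) → EuclideanSpace ℝ (Fin m))
    (k₀ : EuclideanSpace ℝ (Fin d) → EuclideanSpace ℝ (Fin d) → Matrix (Fin m) (Fin m) ℝ)
    (hmean : ∀ (x : X) (i : Fin m), ∫ ω, f x ω i ∂P = μ₀ x i)
    (hcov : ∀ (x y : X) (i j : Fin m), cov[fun ω => f x ω i, fun ω => f y ω j; P] = k₀ x y i j)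
    (hμ₀ : ContDiffOn ℝ 1 μ₀ X)
    (hk₀ : ∀ i j : Fin m, ContDiffOn ℝ 1
      (fun p : EuclideanSpace ℝ (Fin d) × EuclideanSpace ℝ (Fin d) => k₀ p.1 p.2 i j) (X ×ˢ X))
    -- the covariance of the observation noise
    (Sv : X → Matrix (Fin m) (Fin m) ℝ) (hSv : Continuous Sv) (hSvpos : ∀ x, (Sv x).PosDef)
    -- the affine objective and the data
    (g : EuclideanSpace ℝ (Fin m) →ᵃ[ℝ] ℝ) (D : KG.Data X m n)
    -- a root decomposition of the covariance matrix of the observations at `x`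
    (L : (Fin q → X) → Matrix (Fin q × Fin m) (Fin s) ℝ)
    (hL : ∀ x, L x * (L x).transpose = KG.predCov P f Sv D x)
    -- the i.i.d. normal base samples
    {Ω' : Type*} [MeasurableSpace Ω'] (P' : Measure Ω') [IsProbabilityMeasure P']
    (ε : ℕ → Ω' → Fin s → ℝ)
    (hεlaw : ∀ i, HasLaw (ε i) (Measure.pi fun _ : Fin s => gaussianReal 0 1) P')
    (hεind : iIndepFun ε P') :
    -- all expectations and maxima in the definitions of the two functions exist
    ((∀ (n' : ℕ) (D' : KG.Data X m n'),
        IsProbabilityMeasure (KG.posterior P f Sv D') ∧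
        (∀ x', Integrable (fun ω => g (f x' ω)) (KG.posterior P f Sv D')) ∧
        (KG.argmax (KG.condMean P f Sv g D')).Nonempty) ∧
      (∀ x : Fin q → X, Integrable (fun y => KG.bestMean P f Sv g (D.extend x y))
        (KG.predictive P f Sv D x)) ∧
      (KG.argmax (KG.alphaKG (q := q) P f Sv g D)).Nonempty ∧
      (∀ (N : ℕ) (ω : Ω'),
        BddAbove (Set.range (KG.alphaHat P f Sv g D L (fun i => ε i ω) N))) ∧
      (Continuous L → ∀ (N : ℕ) (ω : Ω'),
        (KG.argmax (KG.alphaHat P f Sv g D L (fun i => ε i ω) N)).Nonempty)) ∧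
    -- (1) the optimal values converge almost surely
    (∀ᵐ ω ∂P', Tendsto (fun N => ⨆ x, KG.alphaHat P f Sv g D L (fun i => ε i ω) N x) atTop
      (𝓝 (⨆ x : Fin q → X, KG.alphaKG P f Sv g D x))) ∧
    -- (2) the maximizers converge almost surely to the set of maximizers, however they are chosen
    (∀ᵐ ω ∂P', ∀ δ > 0, ∀ᶠ N in atTop,
      ∀ x ∈ KG.argmax (KG.alphaHat P f Sv g D L (fun i => ε i ω) N),
        Metric.infDist x (KG.argmax (KG.alphaKG P f Sv g D)) < δ) ∧
    -- (3) they do so in probability at an exponential rate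
    (∀ δ > 0, ∃ K : ℝ, ∃ β > 0, ∀ N : ℕ, 1 ≤ N →
      P' {ω | ∃ x ∈ KG.argmax (KG.alphaHat P f Sv g D L (fun i => ε i ω) N),
        δ < Metric.infDist x (KG.argmax (KG.alphaKG P f Sv g D))} ≤
          ENNReal.ofReal (K * Real.exp (-β * N))) := by
  have : CompactSpace X := isCompact_iff_compactSpace.mp hX
  have : Nonempty X := hXne.to_subtype
  have hF : KG.IsContGaussian (KG.coords f) P := KG.isContGaussian_coords hf hmean hcov
    hμ₀.continuousOn fun i j => (hk₀ i j).continuousOn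
  have hpost := fun (n' : ℕ) (D' : KG.Data X m n') => (KG.posterior_spec hF hSvpos D').1
  have hα : Continuous (KG.alphaKG (q := q) P f Sv g D) :=
    KG.continuous_alphaKG g hF hSv hSvpos D fun x => ⟨L x, hL x⟩
  have hbdd := fun (N : ℕ) (ω : Ω') =>
    KG.bddAbove_range_alphaHat g hF hSv hSvpos D hL (fun i => ε i ω) N
  have hunif := fun (η : ℝ) (hη : η > 0) =>
    KG.expSmall_alphaHat_sub_alphaKG g hF hSv hSvpos D hL hεlaw hεind hη
  have harg := fun (δ : ℝ) (hδ : 0 < δ) => KG.expSmall_infDist_argmax hα hunif hδ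
  refine ⟨⟨fun n' D' => ⟨(hpost n' D').isProbabilityMeasure,
    fun x' => KG.integrable_affine g (hpost n' D') x',
    KG.argmax_nonempty_of_continuous (KG.continuous_condMean g D' (hpost n' D'))⟩,
    fun x => KG.integrable_bestMean_extend g hF hSv hSvpos D (M := L x) (hL x),
    KG.argmax_nonempty_of_continuous hα, hbdd, fun hLc N ω =>
    KG.argmax_nonempty_of_continuous (KG.continuous_alphaHat g hF hSv hSvpos D hLc _ N)⟩,
    KG.ae_tendsto_iSup_of_expSmall hα hbdd hunif, ?_, fun δ hδ => ?_⟩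
  -- The countably many radii 1/(k+1) yield one null set that serves every δ.
  · have hae := ae_all_iff.mpr fun k : ℕ =>
      (harg (1 / ((k : ℝ) + 1)) (by positivity)).ae_eventually_notMem
    filter_upwards [hae] with ω hω δ hδ
    obtain ⟨k, hk⟩ := exists_nat_one_div_lt hδ
    filter_upwards [hω k] with N hN x hx
    by_contra hcon
    exact hN ⟨x, hx, hk.trans_le (not_lt.mp hcon)⟩
  · obtain ⟨M, -, β, hβ, h⟩ := harg δ hδ
    exact ⟨M, β, hβ, h⟩
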